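/- Let $m,r\ge 0$ be integers and $\mathfrak g=\mathfrak{gl}_m(\mathbb C)$. Let $\hat{\mathfrak g}_r=\mathfrak g[z]/z^{r+1}\mathfrak g[z]$ be the Takiff algebra, and let $\hat G_r=\{g_0+g_1z+\dots+g_rz^r : g_0\in GL_m(\mathbb C),\ g_i\in\mathfrak g\}$ with multiplication mod $z^{r+1}$ be its group. Identify the dual $\hat{\mathfrak g}_r^\star$ with $\{\sum_{i=0}^r A_iz^{-i-1} : A_i\in\mathfrak g\}$ by $\langle A,B\rangle=\operatorname{Res}_{z=0}\operatorname{Tr}(A(z)B(z))\,dz=\sum_i\operatorname{Tr}(A_iB_i)$. Let $\pi_-$ be the projection of Laurent polynomials in $z$ to their part with negative exponents. The coadjoint action is $\operatorname{Ad}^*_gA=\pi_-[gAg^{-1}]$, with infinitesimal action $\operatorname{ad}^*_\xi A=\pi_-[\xi A-A\xi]$. Each coadjoint orbit carries the Kirillov–Kostant–Souriau form $\omega_{KKS}(\operatorname{ad}^*_\xi A,\operatorname{ad}^*_\eta A)=-\langle A,[\xi,\eta]\rangle$. Let $T^\star\hat{\mathfrak g}_r$ be the space of pairs $(Q,P)$,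 $Q=\sum_{i=0}^rQ_iz^i$, $P=\sum_{i=0}^rP_iz^{-i-1}$, $Q_i,P_i\in\mathfrak g$, with the symplectic form $\omega=d\langle P,dQ\rangle=\sum_i\operatorname{Tr}(dP_i\wedge dQ_i)$ and the inner action $g\cdot(Q,P)=(Qg^{-1}\bmod z^{r+1},\ \pi_-[gP])$ of $\hat G_r$. Put $\Lambda(z)=\pi_-[PQ]$ and $A(z)=\pi_-[QP]$. 1. The inner action is Hamiltonian: it preserves $\omega$, it has moment map $(Q,P)\mapsto\Lambda$, and this map is equivariant. 2. Explicitly, $A(z)=\sum_{k=0}^rA_kz^{-k-1}$ and $\Lambda(z)=\sum_{k=0}^r\Lambda_kz^{-k-1}$ with $$A_k=\sum_{i=0}^{r-k}Q_iP_{i+k},\qquad \Lambda_k=\sum_{i=0}^{r-k}P_{i+k}Q_i .$$ 3. Let $\Lambda_0(z)\in\hat{\mathfrak g}_r^\star$ be arbitrary, and let $\hat{\mathcal O}_r^\star\subset\hat{\mathfrak g}_r^\star$ be its coadjoint orbit. Let $$T^\star\hat{\mathfrak g}_r/\!/_{\Lambda_0}\hat G_r=\{(Q,P):\pi_-[PQ]=\Lambda_0\}/\operatorname{Stab}_{\hat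 G_r}(\Lambda_0)$$ be the Hamiltonian reduction with respect to the inner action. It carries the quotient Zariski topology; its regular functions are the functions whose pull-back to the level set is regular, and its reduced form is the form whose pull-back to the level set is the restriction of $\omega$. The map $(Q,P)\mapsto A(z)=\pi_-[QP]$ is well defined on the reduction, and it is a rational symplectomorphism onto $\hat{\mathcal O}_r^\star$ in the following sense. Let $D$ be either the subset of the reduction where $Q(z)$ is invertible (that is, $\det Q_0\ne0$), or the subset where $z^{r+1}P(z)$ is invertible (that is, $\det P_r\ne0$). Then $D$ is Zariski open and non-empty, and the moment map is submersive at the points of the level set over $D$. The map restricts to a biregular bijection of $D$ onto the whole orbit $\hat{\mathcal O}_r^\star$; in particular $A(z)$ and $\Lambda_0(z)$ lie in the same coadjoint orbit. At each point of $D$ its differential is an isomorphism of the reduced tangent space onto the tangent space of $\hat{\mathcal O}_r^\star$ that carries the reduced form to $\omega_{KKS}$, and both forms are non-degenerate. If the leading coefficient $\Lambda_r$ of $\Lambda_0(z)$ (the coefficient of $z^{-r-1}$) is an invertible matrix, then each of the two sets $D$ is the whole reduction. -/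

import Mathlib

noncomputable section

namespace TakiffReduction

/-! ### The Takiff algebra, its dual and its group -/

/-- The associative algebra underlying `𝔤 = 𝔤𝔩_m(ℂ)`. -/
abbrev Mat (m : ℕ) : Type := Matrix (Fin m) (Fin m) ℂ

/-- Elements `∑ i ≤ r, B i * z ^ i` of the Takiff algebra of degree `r` of `𝔤𝔩_m`,
given by their coefficients. -/
def Takiff (m r : ℕ) : Type := Fin (r + 1) → Mat m

/-- Elements `∑ i ≤ r, A i * z ^ (-i-1)` of the dual of the Takiff algebra, given by their
coefficients. -/
def TakiffDual (m r : ℕ) : Type := Fin (r + 1) → Mat m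

variable {m r : ℕ}

instance : AddCommGroup (Takiff m r) := inferInstanceAs (AddCommGroup (Fin (r + 1) → Mat m))
instance : Module ℂ (Takiff m r) := inferInstanceAs (Module ℂ (Fin (r + 1) → Mat m))
instance : TopologicalSpace (Takiff m r) :=
  inferInstanceAs (TopologicalSpace (Fin (r + 1) → Mat m))
instance : AddCommGroup (TakiffDual m r) := inferInstanceAs (AddCommGroup (Fin (r + 1) → Mat m))
instance : Module ℂ (TakiffDual m r) := inferInstanceAs (Module ℂ (Fin (r + 1) → Mat m))
instance : TopologicalSpace (TakiffDual m r) :=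
  inferInstanceAs (TopologicalSpace (Fin (r + 1) → Mat m))

/-- The coefficient of `z ^ i`. -/
def Takiff.coeff (g : Takiff m r) (i : Fin (r + 1)) : Mat m := g i

/-- The coefficient of `z ^ (-i-1)`. -/
def TakiffDual.coeff (A : TakiffDual m r) (i : Fin (r + 1)) : Mat m := A i

@[ext] theorem Takiff.ext {g h : Takiff m r} (e : ∀ i, g.coeff i = h.coeff i) : g = h := funext e

@[ext] theorem TakiffDual.ext {A B : TakiffDual m r} (e : ∀ i, A.coeff i = B.coeff i) : A = B :=
  funext e

@[simp] theorem Takiff.coeff_add (g h : Takiff m r) (i : Fin (r + 1)) :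
    (g + h).coeff i = g.coeff i + h.coeff i := rfl
@[simp] theorem Takiff.coeff_smul (c : ℂ) (g : Takiff m r) (i : Fin (r + 1)) :
    (c • g).coeff i = c • g.coeff i := rfl
@[simp] theorem Takiff.coeff_zero (i : Fin (r + 1)) : (0 : Takiff m r).coeff i = 0 := rfl
@[simp] theorem TakiffDual.coeff_add (g h : TakiffDual m r) (i : Fin (r + 1)) :
    (g + h).coeff i = g.coeff i + h.coeff i := rfl
@[simp] theorem TakiffDual.coeff_smul (c : ℂ) (g : TakiffDual m r) (i : Fin (r + 1)) :
    (c • g).coeff i = c • g.coeff i := rfl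

/-- Matrix valued Laurent polynomials in the spectral parameter `z`. -/
abbrev MatLaurent (m : ℕ) : Type := LaurentPolynomial (Mat m)

/-- `∑ i, B i * z ^ i` as a Laurent polynomial. -/
def Takiff.toLaurent (g : Takiff m r) : MatLaurent m :=
  ∑ i : Fin (r + 1), AddMonoidAlgebra.single ((i : ℕ) : ℤ) (g.coeff i)

/-- `∑ i, A i * z ^ (-i-1)` as a Laurent polynomial. -/
def TakiffDual.toLaurent (A : TakiffDual m r) : MatLaurent m :=
  ∑ i : Fin (r + 1), AddMonoidAlgebra.single (-((i : ℕ) : ℤ) - 1) (A.coeff i)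

/-- Reduction mod `z ^ (r+1)` of a polynomial in `z`. -/
def modZ (r : ℕ) (f : MatLaurent m) : Takiff m r := fun i => f.coeff ((i : ℕ) : ℤ)

/-- The projection `π₋` to the polar part. It is only applied to Laurent polynomials whose pole has
order at most `r + 1`. -/
def piMinus (r : ℕ) (f : MatLaurent m) : TakiffDual m r := fun i => f.coeff (-((i : ℕ) : ℤ) - 1)

/-- Multiplication mod `z ^ (r+1)`. -/
instance : Mul (Takiff m r) := ⟨fun g h => modZ r (g.toLaurent * h.toLaurent)⟩

instance : One (Takiff m r) := ⟨modZ r 1⟩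

theorem Takiff.coeff_mul (g h : Takiff m r) (k : Fin (r + 1)) :
    (g * h).coeff k = ∑ i : Fin (r + 1), ∑ j : Fin (r + 1),
      if (i : ℕ) + (j : ℕ) = (k : ℕ) then g.coeff i * h.coeff j else 0 := by
  change (g.toLaurent * h.toLaurent).coeff ((k : ℕ) : ℤ) = _
  simp only [Takiff.toLaurent, Finset.sum_mul_sum, AddMonoidAlgebra.single_mul_single,
    AddMonoidAlgebra.coeff_sum, Finsupp.finsetSum_apply, AddMonoidAlgebra.coeff_single,
    Finsupp.single_apply]
  refine Finset.sum_congr rfl fun i _ => Finset.sum_congr rfl fun j _ => ?_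
  norm_cast

theorem Takiff.coeff_one (k : Fin (r + 1)) :
    (1 : Takiff m r).coeff k = if (k : ℕ) = 0 then 1 else 0 := by
  change (1 : MatLaurent m).coeff ((k : ℕ) : ℤ) = _
  rw [AddMonoidAlgebra.one_def, AddMonoidAlgebra.coeff_single, Finsupp.single_apply]
  norm_cast
  simp [eq_comm]

theorem sum_convolution_aux (X : Mat m) (s l : ℕ) (n : Fin (r + 1)) :
    (∑ a : Fin (r + 1), if (a : ℕ) + l = n then (if s = (a : ℕ) then X else 0) else 0) =
      if s + l = n then X else 0 := by
  by_cases h : s + l = n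
  · rw [if_pos h, Finset.sum_eq_single (⟨s, by omega⟩ : Fin (r + 1))]
    · rw [if_pos h, if_pos rfl]
    · intro b _ hb
      have : s ≠ (b : ℕ) := by rintro rfl; exact hb rfl
      simp [this]
    · exact fun h => absurd (Finset.mem_univ _) h
  · rw [if_neg h]
    refine Finset.sum_eq_zero fun a _ => ?_
    split_ifs with h1 h2
    · omega
    all_goals rfl

theorem Takiff.coeff_mul_mul (f g h : Takiff m r) (n : Fin (r + 1)) :
    (f * g * h).coeff n = ∑ l : Fin (r + 1), ∑ i : Fin (r + 1), ∑ j : Fin (r + 1),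
      if (i : ℕ) + j + l = n then f.coeff i * g.coeff j * h.coeff l else 0 := by
  rw [Takiff.coeff_mul, Finset.sum_comm]
  refine Finset.sum_congr rfl fun l _ => ?_
  have h1 : ∀ i j : Fin (r + 1),
      (if (i : ℕ) + j + l = n then f.coeff i * g.coeff j * h.coeff l else 0) =
        ∑ a : Fin (r + 1), if (a : ℕ) + l = n then
          (if (i : ℕ) + j = a then f.coeff i * g.coeff j * h.coeff l else 0) else 0 :=
    fun i j => (sum_convolution_aux _ _ _ _).symm
  simp only [h1]
  rw [Finset.sum_congr rfl fun i _ => Finset.sum_comm, Finset.sum_comm]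
  refine Finset.sum_congr rfl fun a _ => ?_
  split_ifs
  · rw [Takiff.coeff_mul, Finset.sum_mul]
    refine Finset.sum_congr rfl fun i _ => ?_
    rw [Finset.sum_mul]
    exact Finset.sum_congr rfl fun j _ => by split_ifs <;> simp
  · simp

theorem Takiff.mul_assoc_aux (f g h : Takiff m r) : f * g * h = f * (g * h) := by
  ext1 n
  have e2 : (f * (g * h)).coeff n = ∑ i : Fin (r + 1), ∑ j : Fin (r + 1), ∑ l : Fin (r + 1),
      if (i : ℕ) + j + l = n then f.coeff i * g.coeff j * h.coeff l else 0 := by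
    rw [Takiff.coeff_mul]
    refine Finset.sum_congr rfl fun i _ => ?_
    have h1 : ∀ j l : Fin (r + 1),
        (if (i : ℕ) + j + l = n then f.coeff i * g.coeff j * h.coeff l else 0) =
          ∑ a : Fin (r + 1), if (a : ℕ) + i = n then
            (if (j : ℕ) + l = a then f.coeff i * g.coeff j * h.coeff l else 0) else 0 := by
      intro j l
      rw [sum_convolution_aux]
      congr 1
      exact propext ⟨fun _ => by omega, fun _ => by omega⟩
    simp only [h1]
    rw [Finset.sum_congr rfl fun j _ => Finset.sum_comm, Finset.sum_comm]
    refine Finset.sum_congr rfl fun a _ => ?_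
    rw [add_comm (i : ℕ)]
    split_ifs
    · rw [Takiff.coeff_mul, Finset.mul_sum]
      refine Finset.sum_congr rfl fun i _ => ?_
      rw [Finset.mul_sum]
      exact Finset.sum_congr rfl fun j _ => by split_ifs <;> simp [mul_assoc]
    · simp
  rw [Takiff.coeff_mul_mul, e2, Finset.sum_comm]
  exact Finset.sum_congr rfl fun i _ => Finset.sum_comm

theorem Takiff.one_mul_aux (g : Takiff m r) : 1 * g = g := by
  ext1 k
  rw [Takiff.coeff_mul, Finset.sum_eq_single (0 : Fin (r + 1)), Finset.sum_eq_single k]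
  · simp [Takiff.coeff_one]
  · intro b _ hb
    rw [if_neg]
    simpa [Fin.ext_iff] using hb
  · exact fun h => absurd (Finset.mem_univ _) h
  · intro b _ hb
    have : (b : ℕ) ≠ 0 := fun h => hb (Fin.ext h)
    simp [Takiff.coeff_one, this]
  · exact fun h => absurd (Finset.mem_univ _) h

theorem Takiff.mul_one_aux (g : Takiff m r) : g * 1 = g := by
  ext1 k
  rw [Takiff.coeff_mul, Finset.sum_comm, Finset.sum_eq_single (0 : Fin (r + 1)),
    Finset.sum_eq_single k]
  · simp [Takiff.coeff_one]
  · intro b _ hb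
    rw [if_neg]
    simpa [Fin.ext_iff] using hb
  · exact fun h => absurd (Finset.mem_univ _) h
  · intro b _ hb
    have : (b : ℕ) ≠ 0 := fun h => hb (Fin.ext h)
    simp [Takiff.coeff_one, this]
  · exact fun h => absurd (Finset.mem_univ _) h

/-- The associative algebra `𝔤𝔩_m[z] / z ^ (r+1)`. Its commutator is the Takiff bracket. -/
instance : Ring (Takiff m r) :=
  { (inferInstance : AddCommGroup (Takiff m r)) with
    mul := (· * ·)
    one := 1
    mul_assoc := Takiff.mul_assoc_aux
    one_mul := Takiff.one_mul_aux
    mul_one := Takiff.mul_one_aux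
    zero_mul := fun a => by ext1 k; simp [Takiff.coeff_mul]
    mul_zero := fun a => by ext1 k; simp [Takiff.coeff_mul]
    left_distrib := fun a b c => by
      ext1 k
      simp only [Takiff.coeff_mul, Takiff.coeff_add, ← Finset.sum_add_distrib, mul_add]
      exact Finset.sum_congr rfl fun i _ => Finset.sum_congr rfl fun j _ => by split_ifs <;> simp
    right_distrib := fun a b c => by
      ext1 k
      simp only [Takiff.coeff_mul, Takiff.coeff_add, ← Finset.sum_add_distrib, add_mul]
      exact Finset.sum_congr rfl fun i _ => Finset.sum_congr rfl fun j _ => by split_ifs <;> simp }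

theorem Takiff.coeff_zero_mul (g h : Takiff m r) :
    (g * h).coeff 0 = g.coeff 0 * h.coeff 0 := by
  rw [Takiff.coeff_mul, Finset.sum_eq_single (0 : Fin (r + 1)),
    Finset.sum_eq_single (0 : Fin (r + 1))]
  · simp
  · intro b _ hb
    exact if_neg fun h => hb (Fin.ext (by simpa using h))
  · exact fun h => absurd (Finset.mem_univ _) h
  · intro b _ hb
    refine Finset.sum_eq_zero fun j _ => if_neg fun h => hb (Fin.ext ?_)
    simp at h ⊢
    omega
  · exact fun h => absurd (Finset.mem_univ _) h

theorem Takiff.coeff_pow_eq_zero (n : Takiff m r) (h0 : n.coeff 0 = 0) (k : ℕ) :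
    ∀ i : Fin (r + 1), (i : ℕ) < k → (n ^ k).coeff i = 0 := by
  induction k with
  | zero => intro i hi; omega
  | succ k ih =>
    intro i hi
    rw [pow_succ, Takiff.coeff_mul]
    refine Finset.sum_eq_zero fun a _ => Finset.sum_eq_zero fun b _ => ?_
    split_ifs with h
    · by_cases hb : b = 0
      · rw [hb, h0, mul_zero]
      · have : (b : ℕ) ≠ 0 := fun h => hb (Fin.ext h)
        rw [ih a (by omega), zero_mul]
    · rfl

theorem Takiff.isUnit_iff (g : Takiff m r) : IsUnit g ↔ IsUnit (g.coeff 0) := by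
  have h1 : (1 : Takiff m r).coeff 0 = 1 := by simp [Takiff.coeff_one]
  constructor
  · rintro ⟨u, rfl⟩
    refine ⟨⟨_, (u⁻¹).1.coeff 0,
      (Takiff.coeff_zero_mul u.1 (u⁻¹).1).symm.trans (by rw [Units.mul_inv, h1]),
      (Takiff.coeff_zero_mul (u⁻¹).1 u.1).symm.trans (by rw [Units.inv_mul, h1])⟩, rfl⟩
  · rintro ⟨u, hu⟩
    let c : Mat m → Takiff m r := fun B i => if (i : ℕ) = 0 then B else 0
    have hc : ∀ B, (c B).coeff 0 = B := fun B => by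
      change (if ((0 : Fin (r + 1)) : ℕ) = 0 then B else 0) = B
      exact if_pos rfl
    have key : ∀ a : Takiff m r, a.coeff 0 = 1 → IsUnit a := by
      intro a ha
      have hn : IsNilpotent (a - 1) := by
        refine ⟨r + 1, ?_⟩
        ext1 i
        refine Takiff.coeff_pow_eq_zero _ ?_ _ i i.isLt
        change a.coeff 0 - (1 : Takiff m r).coeff 0 = 0
        rw [ha, h1, sub_self]
      simpa using hn.isUnit_one_add
    obtain ⟨v, hv⟩ := key (g * c (u⁻¹).1) (by rw [Takiff.coeff_zero_mul, hc, ← hu]; simp)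
    obtain ⟨w, hw⟩ := key (c (u⁻¹).1 * g) (by rw [Takiff.coeff_zero_mul, hc, ← hu]; simp)
    refine isUnit_iff_exists.2 ?_
    have hl : (w⁻¹).1 * c (u⁻¹).1 * g = 1 := by rw [mul_assoc, ← hw]; simp
    have hr : g * (c (u⁻¹).1 * (v⁻¹).1) = 1 := by rw [← mul_assoc, ← hv]; simp
    exact ⟨_, hr, by rw [← left_inv_eq_right_inv hl hr]; exact hl⟩

/-- The group of the Takiff algebra: the units of `𝔤𝔩_m[z] / z ^ (r+1)`, which are the
`g 0 + g 1 * z + ⋯ + g r * z ^ r` with `g 0` invertible. -/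
abbrev TakiffGroup (m r : ℕ) : Type := (Takiff m r)ˣ

/-! ### Pairing and coadjoint action -/

/-- The pairing of the Takiff algebra with its dual, `Res_{z = 0} Tr (A(z) B(z)) dz`. -/
def pairing (A : TakiffDual m r) (B : Takiff m r) : ℂ :=
  ∑ i : Fin (r + 1), (A.coeff i * B.coeff i).trace

/-- Multiplication by `z ^ (r+1)`, as a map from the dual to the Takiff algebra. -/
def TakiffDual.shift (A : TakiffDual m r) : Takiff m r := fun i => A i.rev

theorem TakiffDual.shift_injective :
    Function.Injective (TakiffDual.shift : TakiffDual m r → Takiff m r) := by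
  intro A B h
  ext1 i
  have h' : A i.rev.rev = B i.rev.rev := congrFun h i.rev
  rwa [Fin.rev_rev] at h'

theorem shift_piMinus_mul_mul (g : Takiff m r) (A : TakiffDual m r) (h : Takiff m r) :
    (piMinus r (g.toLaurent * A.toLaurent * h.toLaurent)).shift = g * A.shift * h := by
  ext1 n
  rw [Takiff.coeff_mul_mul]
  change (g.toLaurent * A.toLaurent * h.toLaurent).coeff (-((n.rev : ℕ) : ℤ) - 1) = _
  simp only [Takiff.toLaurent, TakiffDual.toLaurent, Finset.sum_mul, Finset.mul_sum, AddMonoidAlgebra.single_mul_single,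
    AddMonoidAlgebra.coeff_sum, Finsupp.finsetSum_apply, AddMonoidAlgebra.coeff_single,
    Finsupp.single_apply]
  refine Finset.sum_congr rfl fun l _ => ?_
  rw [Finset.sum_comm]
  refine Finset.sum_congr rfl fun i _ => ?_
  rw [← Equiv.sum_comp Fin.revPerm]
  refine Finset.sum_congr rfl fun j _ => ?_
  simp only [Fin.revPerm_apply, Fin.val_rev]
  have hj := j.isLt
  have hn := n.isLt
  have e : ((i : ℕ) : ℤ) + (-((r + 1 - (j + 1) : ℕ) : ℤ) - 1) + ((l : ℕ) : ℤ) =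
      -((r + 1 - (n + 1) : ℕ) : ℤ) - 1 ↔ (i : ℕ) + j + l = n := by omega
  rw [if_congr e rfl rfl]
  rfl

theorem Takiff.toLaurent_one : (1 : Takiff m r).toLaurent = 1 := by
  rw [Takiff.toLaurent, Finset.sum_eq_single (0 : Fin (r + 1))]
  · rw [Takiff.coeff_one, if_pos (by rfl), AddMonoidAlgebra.one_def]
    rfl
  · intro b _ hb
    have : (b : ℕ) ≠ 0 := fun h => hb (Fin.ext h)
    simp [Takiff.coeff_one, this]
  · exact fun h => absurd (Finset.mem_univ _) h

theorem shift_piMinus_mul (g : Takiff m r) (A : TakiffDual m r) :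
    (piMinus r (g.toLaurent * A.toLaurent)).shift = g * A.shift := by
  simpa [Takiff.toLaurent_one] using shift_piMinus_mul_mul g A 1

/-- The coadjoint action `Ad*_g A = π₋[g A g⁻¹]`. -/
instance : MulAction (TakiffGroup m r) (TakiffDual m r) where
  smul g A := piMinus r
    ((g : Takiff m r).toLaurent * A.toLaurent * ((g⁻¹ : TakiffGroup m r) : Takiff m r).toLaurent)
  one_smul A := by
    apply TakiffDual.shift_injective
    refine (shift_piMinus_mul_mul _ _ _).trans ?_
    simp
  mul_smul g h A := by
    apply TakiffDual.shift_injective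
    refine (shift_piMinus_mul_mul _ _ _).trans ?_
    refine Eq.trans ?_ (shift_piMinus_mul_mul _ _ _).symm
    change _ = _ * (piMinus r _).shift * _
    rw [shift_piMinus_mul_mul]
    simp [mul_assoc]

theorem Takiff.toLaurent_add (g h : Takiff m r) :
    (g + h).toLaurent = g.toLaurent + h.toLaurent := by
  simp [Takiff.toLaurent, Finset.sum_add_distrib]

theorem Takiff.toLaurent_smul (c : ℂ) (g : Takiff m r) :
    (c • g).toLaurent = c • g.toLaurent := by
  simp only [Takiff.toLaurent, Finset.smul_sum, Takiff.coeff_smul, AddMonoidAlgebra.smul_single]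

theorem piMinus_add (f g : MatLaurent m) : piMinus r (f + g) = piMinus r f + piMinus r g := rfl

theorem piMinus_smul (c : ℂ) (f : MatLaurent m) : piMinus r (c • f) = c • piMinus r f := rfl

/-- The infinitesimal coadjoint action `ξ ↦ ad*_ξ A = π₋[ξ A - A ξ]`. -/
def coad (A : TakiffDual m r) : Takiff m r →ₗ[ℂ] TakiffDual m r where
  toFun ξ := piMinus r (ξ.toLaurent * A.toLaurent - A.toLaurent * ξ.toLaurent)
  map_add' ξ η := by
    rw [← piMinus_add, Takiff.toLaurent_add]
    congr 1
    noncomm_ring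
  map_smul' c ξ := by
    rw [RingHom.id_apply, ← piMinus_smul, Takiff.toLaurent_smul, smul_sub, smul_mul_assoc,
      mul_smul_comm]

/-- The tangent space at `A` of the coadjoint orbit through `A`. -/
def orbitTangent (A : TakiffDual m r) : Submodule ℂ (TakiffDual m r) := LinearMap.range (coad A)

/-- `K` is the Kirillov-Kostant-Souriau form at the point `A` of its coadjoint orbit:
`K (ad*_ξ A, ad*_η A) = - ⟨A, [ξ, η]⟩`. -/
def IsKKSForm (A : TakiffDual m r) (K : LinearMap.BilinForm ℂ (orbitTangent A)) : Prop :=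
  ∀ ξ η : Takiff m r,
    K ⟨coad A ξ, ξ, rfl⟩ ⟨coad A η, η, rfl⟩ = -pairing A (ξ * η - η * ξ)

/-! ### The extended phase space, the inner action and the two moment maps -/

/-- The cotangent bundle of the Takiff algebra: pairs `(Q, P)` with `Q = ∑ i, Q i * z ^ i` and
`P = ∑ i, P i * z ^ (-i-1)`. -/
def PhaseSpace (m r : ℕ) : Type := Takiff m r × TakiffDual m r

instance : AddCommGroup (PhaseSpace m r) :=
  inferInstanceAs (AddCommGroup (Takiff m r × TakiffDual m r))
instance : Module ℂ (PhaseSpace m r) := inferInstanceAs (Module ℂ (Takiff m r × TakiffDual m r))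
instance : TopologicalSpace (PhaseSpace m r) :=
  inferInstanceAs (TopologicalSpace (Takiff m r × TakiffDual m r))

def PhaseSpace.Q (x : PhaseSpace m r) : Takiff m r := x.1

def PhaseSpace.P (x : PhaseSpace m r) : TakiffDual m r := x.2

@[ext] theorem PhaseSpace.ext {x y : PhaseSpace m r} (hQ : x.Q = y.Q) (hP : x.P = y.P) : x = y :=
  Prod.ext hQ hP

/-- The symplectic form `d⟨P, dQ⟩ = ∑ i, Tr (dP i ∧ dQ i)`; it has constant coefficients. -/
def omega (u v : PhaseSpace m r) : ℂ := pairing u.P v.Q - pairing v.P u.Q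

/-- The inner action `g • (Q, P) = (Q g⁻¹ mod z ^ (r+1), π₋[g P])`. -/
instance : MulAction (TakiffGroup m r) (PhaseSpace m r) where
  smul g x := (x.Q * ((g⁻¹ : TakiffGroup m r) : Takiff m r),
    piMinus r ((g : Takiff m r).toLaurent * x.P.toLaurent))
  one_smul x := by
    refine PhaseSpace.ext ?_ ?_
    · exact (mul_one x.Q)
    · apply TakiffDual.shift_injective
      refine (shift_piMinus_mul _ _).trans ?_
      simp
  mul_smul g h x := by
    refine PhaseSpace.ext ?_ ?_
    · change x.Q * _ = x.Q * _ * _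
      simp [mul_assoc]
    · apply TakiffDual.shift_injective
      refine (shift_piMinus_mul _ _).trans ?_
      refine Eq.trans ?_ (shift_piMinus_mul _ _).symm
      change _ = _ * (piMinus r _).shift
      rw [shift_piMinus_mul]
      simp [mul_assoc]

/-- The infinitesimal inner action `ξ ↦ (-Q ξ mod z ^ (r+1), π₋[ξ P])` at the point `(Q, P)`. -/
def innerInf (x : PhaseSpace m r) : Takiff m r →ₗ[ℂ] PhaseSpace m r where
  toFun ξ := (-(x.Q * ξ), piMinus r (ξ.toLaurent * x.P.toLaurent))
  map_add' ξ η := by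
    refine PhaseSpace.ext ?_ ?_
    · change -(x.Q * (ξ + η)) = -(x.Q * ξ) + -(x.Q * η)
      noncomm_ring
    · change piMinus r _ = piMinus r _ + piMinus r _
      rw [← piMinus_add, Takiff.toLaurent_add, add_mul]
  map_smul' c ξ := by
    refine PhaseSpace.ext ?_ ?_
    · change -(x.Q * (c • ξ)) = c • -(x.Q * ξ)
      rw [smul_neg]
      congr 1
      ext1 k
      simp [Takiff.coeff_mul, Finset.smul_sum]
    · change piMinus r _ = c • piMinus r _
      rw [← piMinus_smul, Takiff.toLaurent_smul, smul_mul_assoc]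

/-- The moment map of the inner action, `Λ(z) = π₋[P Q]`. -/
def momentInner (x : PhaseSpace m r) : TakiffDual m r := piMinus r (x.P.toLaurent * x.Q.toLaurent)

/-- `A(z) = π₋[Q P]`. -/
def matA (x : PhaseSpace m r) : TakiffDual m r := piMinus r (x.Q.toLaurent * x.P.toLaurent)

theorem matA_smul (g : TakiffGroup m r) (x : PhaseSpace m r) : matA (g • x) = matA x := by
  apply TakiffDual.shift_injective
  refine (shift_piMinus_mul _ _).trans ?_
  refine Eq.trans ?_ (shift_piMinus_mul _ _).symm
  change x.Q * _ * (piMinus r _).shift = _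
  rw [shift_piMinus_mul]
  simp [mul_assoc]

/-! ### Spaces with functions -/

/-- The data of a classical algebraic variety, as a space with functions: its Zariski open subsets,
and, for `U` open, the functions which are regular on `U` (only their values on `U` matter). -/
structure SpaceWithFunctions (X : Type) where
  IsOpen : Set X → Prop
  IsRegularOn : Set X → (X → ℂ) → Prop

/-- The polynomial functions on a complex vector space. -/
def polyFun (V : Type) [AddCommGroup V] [Module ℂ V] : Subalgebra ℂ (V → ℂ) :=
  Algebra.adjoin ℂ {f | ∃ l : Module.Dual ℂ V, f = fun v => l v}

/-- A complex vector space with its Zariski topology and its regular functions, which are locally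
quotients of polynomials. -/
def affineSpace (V : Type) [AddCommGroup V] [Module ℂ V] : SpaceWithFunctions V where
  IsOpen U := ∀ x ∈ U, ∃ b ∈ polyFun V, b x ≠ 0 ∧ ∀ y, b y ≠ 0 → y ∈ U
  IsRegularOn U f := ∀ x ∈ U, ∃ a ∈ polyFun V, ∃ b ∈ polyFun V, b x ≠ 0 ∧
    ∀ y ∈ U, b y ≠ 0 → f y = a y / b y

/-- The induced structure on a subset: the subspace topology, and the functions that extend
locally to regular functions of the ambient space. -/
def SpaceWithFunctions.sub {X : Type} (𝒳 : SpaceWithFunctions X) (S : Set X) :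
    SpaceWithFunctions S where
  IsOpen U := ∃ W, 𝒳.IsOpen W ∧ U = Subtype.val ⁻¹' W
  IsRegularOn U f := ∀ x ∈ U, ∃ W, 𝒳.IsOpen W ∧ x.1 ∈ W ∧ ∃ h, 𝒳.IsRegularOn W h ∧
    ∀ y ∈ U, y.1 ∈ W → f y = h y.1

/-- The quotient structure: the quotient topology, and the functions whose pull-back is regular. -/
def SpaceWithFunctions.quotient {X : Type} (𝒳 : SpaceWithFunctions X) (s : Setoid X) :
    SpaceWithFunctions (Quotient s) where
  IsOpen U := 𝒳.IsOpen (Quotient.mk s ⁻¹' U)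
  IsRegularOn U f := 𝒳.IsRegularOn (Quotient.mk s ⁻¹' U) (f ∘ Quotient.mk s)

/-- Isomorphisms (biregular maps) of spaces with functions. -/
structure IsBiregular {X Y : Type} (𝒳 : SpaceWithFunctions X) (𝒴 : SpaceWithFunctions Y)
    (φ : X → Y) : Prop where
  bijective : Function.Bijective φ
  isOpen_iff : ∀ U : Set Y, 𝒴.IsOpen U ↔ 𝒳.IsOpen (φ ⁻¹' U)
  isRegularOn_iff : ∀ U : Set Y, 𝒴.IsOpen U → ∀ f : Y → ℂ,
    𝒴.IsRegularOn U f ↔ 𝒳.IsRegularOn (φ ⁻¹' U) (f ∘ φ)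

/-! ### The Hamiltonian reduction -/

/-- The level set of the inner moment map. -/
abbrev levelSet (L : TakiffDual m r) : Set (PhaseSpace m r) := {x | momentInner x = L}

/-- Two points of the level set of `L` are identified when they differ by the inner action of an
element of the stabilizer of `L` in the Takiff group. -/
def reductionSetoid (L : TakiffDual m r) : Setoid (levelSet L) :=
  (MulAction.orbitRel (MulAction.stabilizer (TakiffGroup m r) L) (PhaseSpace m r)).comap
    Subtype.val

/-- The Hamiltonian reduction of the phase space with respect to the inner action, at the
value `L` of the moment map. -/
abbrev Reduction (L : TakiffDual m r) : Type := Quotient (reductionSetoid L)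

/-- The Hamiltonian reduction as a geometric quotient. -/
def reductionSpace (L : TakiffDual m r) : SpaceWithFunctions (Reduction L) :=
  ((affineSpace (PhaseSpace m r)).sub (levelSet L)).quotient (reductionSetoid L)

/-- The coadjoint orbit of `L`, as a subvariety of the dual of the Takiff algebra. -/
def orbitSpace (L : TakiffDual m r) :
    SpaceWithFunctions (MulAction.orbit (TakiffGroup m r) L) :=
  (affineSpace (TakiffDual m r)).sub (MulAction.orbit (TakiffGroup m r) L)

/-- The map induced by `(Q, P) ↦ A(z) = π₋[Q P]` on the Hamiltonian reduction. -/
def reducedMap (L : TakiffDual m r) : Reduction L → TakiffDual m r :=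
  Quotient.lift (fun x => matA x.1) (by
    rintro x y ⟨g, hg⟩
    have hg' : (g : TakiffGroup m r) • y.1 = x.1 := hg
    rw [← hg', matA_smul])

/-- The differential of the inner moment map. -/
def dMoment (x : PhaseSpace m r) : PhaseSpace m r →ₗ[ℂ] TakiffDual m r :=
  (fderiv ℂ (momentInner (m := m) (r := r)) x).toLinearMap

/-- The differential of `(Q, P) ↦ A(z)`. -/
def dA (x : PhaseSpace m r) : PhaseSpace m r →ₗ[ℂ] TakiffDual m r :=
  (fderiv ℂ (matA (m := m) (r := r)) x).toLinearMap

/-- The tangent space at `x` of the level set through `x` of the inner moment map. -/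
abbrev levelTangent (x : PhaseSpace m r) : Submodule ℂ (PhaseSpace m r) :=
  LinearMap.ker (dMoment x)

/-- The tangent directions at `x` along the inner action of the stabilizer of `Λ(x)`, whose Lie
algebra is the kernel of `ξ ↦ ad*_ξ Λ(x)`. -/
def stabTangent (x : PhaseSpace m r) : Submodule ℂ (PhaseSpace m r) :=
  (LinearMap.ker (coad (momentInner x))).map (innerInf x)

/-- The tangent space of the Hamiltonian reduction at the class of `x`. -/
abbrev reducedTangent (x : PhaseSpace m r) : Type :=
  levelTangent x ⧸ (stabTangent x).comap (levelTangent x).subtype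

/-- `Ω` is the reduced symplectic form at the class of `x`: its pull-back to the level set is the
restriction of `omega`. -/
def IsReducedForm (x : PhaseSpace m r) (Ω : LinearMap.BilinForm ℂ (reducedTangent x)) : Prop :=
  ∀ u v : levelTangent x,
    Ω (Submodule.Quotient.mk u) (Submodule.Quotient.mk v) = omega u.1 v.1

/-- The inner action is a Hamiltonian action by symplectic maps, with equivariant moment map
`momentInner`. -/
structure InnerActionIsHamiltonian (m r : ℕ) : Prop where
  symplectic : ∀ (g : TakiffGroup m r) (u v : PhaseSpace m r), omega (g • u) (g • v) = omega u v
  moment : ∀ (ξ : Takiff m r) (x v : PhaseSpace m r),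
    omega (innerInf x ξ) v = pairing (dMoment x v) ξ
  equivariant : ∀ (g : TakiffGroup m r) (x : PhaseSpace m r),
    momentInner (g • x) = g • momentInner x

/-- The reduced map restricts to a symplectomorphism from the nonempty Zariski open subset `D` of
the Hamiltonian reduction at `L` onto the whole coadjoint orbit of `L`: an isomorphism of algebraic
varieties whose differential takes the reduced symplectic form to the
Kirillov-Kostant-Souriau form. -/
structure IsSymplectomorphismOn (L : TakiffDual m r) (D : Set (Reduction L)) : Prop where
  isOpen : (reductionSpace L).IsOpen D
  nonempty : D.Nonempty
  mapsTo : Set.MapsTo (reducedMap L) D (MulAction.orbit (TakiffGroup m r) L)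
  isBiregular : IsBiregular ((reductionSpace L).sub D) (orbitSpace L)
    (Set.MapsTo.restrict (reducedMap L) D (MulAction.orbit (TakiffGroup m r) L) mapsTo)
  /-- `L` is a regular value on the part of the level set over `D`. -/
  surjective : ∀ x : levelSet L, Quotient.mk (reductionSetoid L) x ∈ D →
    Function.Surjective (dMoment x.1)
  symplectic : ∀ x : levelSet L, Quotient.mk (reductionSetoid L) x ∈ D →
    ∃ (Ω : LinearMap.BilinForm ℂ (reducedTangent x.1))
      (K : LinearMap.BilinForm ℂ (orbitTangent (matA x.1)))
      (Φ : reducedTangent x.1 ≃ₗ[ℂ] orbitTangent (matA x.1)),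
      IsReducedForm x.1 Ω ∧ Ω.Nondegenerate ∧ IsKKSForm (matA x.1) K ∧ K.Nondegenerate ∧
      (∀ u : levelTangent x.1, (Φ (Submodule.Quotient.mk u) : TakiffDual m r) = dA x.1 u.1) ∧
      ∀ a b : reducedTangent x.1, K (Φ a) (Φ b) = Ω a b

/-- The part of the reduction where `Q(z)` is invertible, that is, `Q 0` is. -/
def domainQ (L : TakiffDual m r) : Set (Reduction L) :=
  Quotient.mk (reductionSetoid L) '' {x | IsUnit (x.1.Q.coeff 0)}

/-- The part of the reduction where `z ^ (r+1) P(z)` is invertible, that is, `P r` is. -/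
def domainP (L : TakiffDual m r) : Set (Reduction L) :=
  Quotient.mk (reductionSetoid L) '' {x | IsUnit (x.1.P.coeff (Fin.last r))}

end TakiffReduction

end

open TakiffReduction

/-! Multiplication by `z ^ (r+1)` (`TakiffDual.shift`) identifies the dual with the associative
algebra `R = 𝔤𝔩_m[z] / z ^ (r+1)` itself. Writing `q = Q` and `p = z ^ (r+1) P`, the two moment maps
become the products `Λ = p q` and `A = q p` in `R`, the coadjoint action becomes conjugation, and
the pairing becomes the trace form `Tr` of the coefficient of `z ^ r` in a product. Everything then
reduces to algebra in `R`.

If `q` is invertible then `q p = q (p q) q⁻¹`, and if `p` is invertible then `q p = p⁻¹ (p q) p`; so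
`A` lies in the orbit of `Λ`. Two such points with equal `Λ` and `A` differ by the inner action of
`q⁻¹ q'`, respectively `p p'⁻¹`.

The inverse map is regular because the orbit map has local regular sections
(`exists_regular_conjugator`). The elements `q` with `q L = y q` form the kernel of a linear map
depending linearly on `y`, whose rank is constant along the orbit, so a kernel element at one point
extends to a regular family (`exists_regular_kernel_section`). The points `(q, L q⁻¹)` and `(q L,
q⁻¹)` then lie over `y` in the two domains.

For the forms, the outer vector fields `(ξ q, -p ξ)` span the tangent space of the level set at a
nondegenerate point (`exists_outerInf_eq`). The differential of `A` sends them to `ad*_ξ A`, `omega`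
takes the KKS values on them (`omega_outerInf`), and those sent to zero are the stabilizer
directions (`outerInf_mem_stabTangent`). -/

namespace TakiffReduction

open Filter

/-! ### Regular maps at a point, and linear systems with regular coefficients. -/

section Regular

variable {V : Type} [AddCommGroup V] [Module ℂ V]
variable {W : Type} [AddCommGroup W] [Module ℂ W]
variable {E : Type*} [AddCommGroup E] [Module ℂ E]
variable {E' : Type*} [AddCommGroup E'] [Module ℂ E']

theorem dual_mem_polyFun (l : Module.Dual ℂ V) : (fun v => l v) ∈ polyFun V :=
  Algebra.subset_adjoin ⟨l, rfl⟩

/-- The filter of Zariski neighbourhoods of a point. -/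
def zNhds (x : V) : Filter V where
  sets := {U | ∃ b ∈ polyFun V, b x ≠ 0 ∧ ∀ y, b y ≠ 0 → y ∈ U}
  univ_sets := ⟨1, one_mem _, one_ne_zero, fun _ _ => trivial⟩
  sets_of_superset := fun ⟨b, hb, hx, h⟩ hU => ⟨b, hb, hx, fun y hy => hU (h y hy)⟩
  inter_sets := fun ⟨b, hb, hx, h⟩ ⟨b', hb', hx', h'⟩ => ⟨b * b', mul_mem hb hb',
    mul_ne_zero hx hx', fun y hy => ⟨h y (left_ne_zero_of_mul hy), h' y (right_ne_zero_of_mul hy)⟩⟩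

theorem self_mem_of_mem_zNhds {x : V} {U : Set V} (h : U ∈ zNhds x) : x ∈ U := by
  obtain ⟨b, -, hx, h⟩ := h
  exact h x hx

theorem isOpen_ne_zero {b : V → ℂ} (hb : b ∈ polyFun V) :
    (affineSpace V).IsOpen {y | b y ≠ 0} :=
  fun _ hx => ⟨b, hb, hx, fun _ hy => hy⟩

theorem exists_isOpen_of_mem_zNhds {x : V} {U : Set V} (h : U ∈ zNhds x) :
    ∃ O ⊆ U, x ∈ O ∧ (affineSpace V).IsOpen O := by
  obtain ⟨b, hb, hx, h⟩ := h
  exact ⟨_, fun y hy => h y hy, hx, isOpen_ne_zero hb⟩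

/-- The functions which are regular in a Zariski neighbourhood of a point. -/
def regAt (x : V) : Subalgebra ℂ (V → ℂ) where
  carrier := {f | ∃ a ∈ polyFun V, ∃ b ∈ polyFun V, b x ≠ 0 ∧ ∀ y, b y ≠ 0 → f y = a y / b y}
  mul_mem' := by
    rintro f g ⟨a, ha, b, hb, hx, h⟩ ⟨a', ha', b', hb', hx', h'⟩
    refine ⟨a * a', mul_mem ha ha', b * b', mul_mem hb hb', mul_ne_zero hx hx', fun y hy => ?_⟩
    simp [h y (left_ne_zero_of_mul hy), h' y (right_ne_zero_of_mul hy), div_mul_div_comm]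
  add_mem' := by
    rintro f g ⟨a, ha, b, hb, hx, h⟩ ⟨a', ha', b', hb', hx', h'⟩
    refine ⟨a * b' + b * a', add_mem (mul_mem ha hb') (mul_mem hb ha'), b * b', mul_mem hb hb',
      mul_ne_zero hx hx', fun y hy => ?_⟩
    have h1 := left_ne_zero_of_mul hy
    have h2 := right_ne_zero_of_mul hy
    simp [h y h1, h' y h2, div_add_div _ _ h1 h2]
  algebraMap_mem' c := ⟨algebraMap ℂ _ c, Subalgebra.algebraMap_mem _ c, 1, one_mem _,
    one_ne_zero, fun y _ => by simp⟩

theorem polyFun_le_regAt (x : V) : polyFun V ≤ regAt x := fun f hf =>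
  ⟨f, hf, 1, one_mem _, one_ne_zero, fun y _ => by simp⟩

theorem eventually_ne_zero {x : V} {f : V → ℂ} (hf : f ∈ regAt x) (h0 : f x ≠ 0) :
    ∀ᶠ y in zNhds x, f y ≠ 0 := by
  obtain ⟨a, ha, b, hb, hx, h⟩ := hf
  have hax : a x ≠ 0 := fun h' => h0 (by rw [h x hx, h', zero_div])
  refine ⟨a * b, mul_mem ha hb, mul_ne_zero hax hx, fun y hy => ?_⟩
  change f y ≠ 0
  rw [h y (right_ne_zero_of_mul hy)]
  exact div_ne_zero (left_ne_zero_of_mul hy) (right_ne_zero_of_mul hy)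

theorem eventually_mem_regAt {x : V} {f : V → ℂ} (hf : f ∈ regAt x) :
    ∀ᶠ y in zNhds x, f ∈ regAt y := by
  obtain ⟨a, ha, b, hb, hx, h⟩ := hf
  exact ⟨b, hb, hx, fun y hy => ⟨a, ha, b, hb, hy, h⟩⟩

theorem isOpen_setOf_mem_zNhds (U : Set V) : (affineSpace V).IsOpen {x | U ∈ zNhds x} :=
  fun _ ⟨b, hb, hx, h⟩ => ⟨b, hb, hx, fun _ hy => ⟨b, hb, hy, h⟩⟩

/-- The definition of `IsRegularOn` constrains `f` only on `U`, that of `regAt` wherever the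
denominator is nonzero. Multiplying numerator and denominator by a polynomial whose nonvanishing
locus lies in `U` passes from the first to the second. -/
theorem isRegularOn_affineSpace {U : Set V} (hU : (affineSpace V).IsOpen U) {f : V → ℂ} :
    (affineSpace V).IsRegularOn U f ↔ ∀ x ∈ U, f ∈ regAt x := by
  refine forall₂_congr fun x hxU => ⟨?_, ?_⟩
  · rintro ⟨a, ha, b, hb, hx, h⟩
    obtain ⟨c, hc, hcx, hcU⟩ := hU x hxU
    refine ⟨a * c, mul_mem ha hc, b * c, mul_mem hb hc, mul_ne_zero hx hcx, fun y hy => ?_⟩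
    have h1 := right_ne_zero_of_mul hy
    rw [h y (hcU y h1) (left_ne_zero_of_mul hy)]
    exact (mul_div_mul_right _ _ h1).symm
  · rintro ⟨a, ha, b, hb, hx, h⟩
    exact ⟨a, ha, b, hb, hx, fun y _ hy => h y hy⟩

theorem inv_mem_regAt {x : V} {f : V → ℂ} (hf : f ∈ regAt x) (h0 : f x ≠ 0) :
    f⁻¹ ∈ regAt x := by
  obtain ⟨a, ha, b, hb, hx, h⟩ := hf
  have hax : a x ≠ 0 := fun h' => h0 (by rw [h x hx, h', zero_div])
  -- The fraction `b / a` is expanded by `b`, so that a nonzero denominator also makes `f = a / b`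
  -- available.
  refine ⟨b * b, mul_mem hb hb, a * b, mul_mem ha hb, mul_ne_zero hax hx, fun y hy => ?_⟩
  have h1 := right_ne_zero_of_mul hy
  have h2 := left_ne_zero_of_mul hy
  simp only [Pi.inv_apply, Pi.mul_apply, h y h1]
  field_simp

/-- A map to a vector space is regular at a point when its coordinates are. -/
def IsRegAt (x : V) (s : V → E) : Prop := ∀ l : Module.Dual ℂ E, (fun y => l (s y)) ∈ regAt x

theorem isRegAt_id (x : V) : IsRegAt x (fun y => y) := fun l =>
  polyFun_le_regAt x (dual_mem_polyFun l)

theorem isRegAt_const (x : V) (e : E) : IsRegAt x (fun _ => e) := fun l =>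
  Subalgebra.algebraMap_mem _ (l e)

theorem IsRegAt.linear {x : V} {s : V → E} (hs : IsRegAt x s) (T : E →ₗ[ℂ] E') :
    IsRegAt x (fun y => T (s y)) := fun l => hs (l ∘ₗ T)

theorem IsRegAt.add {x : V} {s t : V → E} (hs : IsRegAt x s) (ht : IsRegAt x t) :
    IsRegAt x (fun y => s y + t y) := fun l => by
  simpa using! add_mem (hs l) (ht l)

theorem IsRegAt.sub {x : V} {s t : V → E} (hs : IsRegAt x s) (ht : IsRegAt x t) :
    IsRegAt x (fun y => s y - t y) := fun l => by
  simpa using! sub_mem (hs l) (ht l)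

theorem IsRegAt.smul {x : V} {c : V → ℂ} {s : V → E} (hc : c ∈ regAt x) (hs : IsRegAt x s) :
    IsRegAt x (fun y => c y • s y) := fun l => by
  simpa using! mul_mem hc (hs l)

theorem IsRegAt.sum {ι : Type*} {x : V} {S : Finset ι} {s : ι → V → E}
    (hs : ∀ i ∈ S, IsRegAt x (s i)) : IsRegAt x (fun y => ∑ i ∈ S, s i y) := fun l => by
  have := sum_mem (S := regAt x) (t := S) fun i hi => hs i hi l
  convert this using 1
  ext y
  simp

theorem IsRegAt.bilin {E₂ : Type*} [AddCommGroup E₂] [Module ℂ E₂] [FiniteDimensional ℂ E]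
    {x : V} {s : V → E} {t : V → E₂} (B : E →ₗ[ℂ] E₂ →ₗ[ℂ] E') (hs : IsRegAt x s)
    (ht : IsRegAt x t) : IsRegAt x (fun y => B (s y) (t y)) := by
  let b := Module.finBasis ℂ E
  have h : ∀ y, B (s y) (t y) = ∑ i, b.coord i (s y) • B (b i) (t y) := fun y => by
    conv_lhs => rw [← b.sum_repr (s y), map_sum, LinearMap.sum_apply]
    simp
  simp only [h]
  exact IsRegAt.sum fun i _ => (IsRegAt.smul (hs _) (ht.linear _))

theorem IsRegAt.prod {x : V} {s : V → E} {t : V → E'} (hs : IsRegAt x s) (ht : IsRegAt x t) :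
    IsRegAt x (fun y => (s y, t y)) := by
  have := (hs.linear (LinearMap.inl ℂ E E')).add (ht.linear (LinearMap.inr ℂ E E'))
  simpa using this

theorem IsRegAt.comp_polyFun {x : V} {s : V → W} (hs : IsRegAt x s) {g : W → ℂ}
    (hg : g ∈ polyFun W) : (fun y => g (s y)) ∈ regAt x := by
  induction hg using Algebra.adjoin_induction with
  | mem f hf => obtain ⟨l, rfl⟩ := hf; exact hs l
  | algebraMap c => exact Subalgebra.algebraMap_mem _ c
  | add f g _ _ hf hg => exact add_mem hf hg
  | mul f g _ _ hf hg => exact mul_mem hf hg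

theorem IsRegAt.tendsto {x : V} {s : V → W} (hs : IsRegAt x s) :
    Tendsto s (zNhds x) (zNhds (s x)) := by
  rintro U ⟨b, hb, hx, h⟩
  exact mem_of_superset (eventually_ne_zero (hs.comp_polyFun hb) hx) fun y hy => h _ hy

theorem IsRegAt.comp_regAt {x : V} {s : V → W} (hs : IsRegAt x s) {g : W → ℂ}
    (hg : g ∈ regAt (s x)) : (fun y => g (s y)) ∈ regAt x := by
  obtain ⟨a, ha, b, hb, hx, h⟩ := hg
  -- The factor `c` keeps `y` where `b (s y) ≠ 0`, so that the formula for `g` can be used at `s y`.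
  obtain ⟨c, hc, hcx, hcb⟩ := eventually_ne_zero (hs.comp_polyFun hb) hx
  obtain ⟨a', ha', b', hb', hx', h'⟩ :=
    mul_mem (hs.comp_polyFun ha) (inv_mem_regAt (hs.comp_polyFun hb) hx)
  refine ⟨a' * c, mul_mem ha' hc, b' * c, mul_mem hb' hc, mul_ne_zero hx' hcx, fun y hy => ?_⟩
  have h1 := right_ne_zero_of_mul hy
  refine (h _ (hcb y h1)).trans ?_
  rw [div_eq_mul_inv]
  refine (h' y (left_ne_zero_of_mul hy)).trans ?_
  simp [mul_div_mul_right _ _ h1]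

theorem isOpen_preimage {s : V → W} (hs : ∀ x, IsRegAt x s) {U : Set W}
    (hU : (affineSpace W).IsOpen U) : (affineSpace V).IsOpen (s ⁻¹' U) := fun x hx =>
  (hs x).tendsto (hU _ hx)

/-- The entries form a matrix over the commutative ring `regAt x`. Its determinant and adjugate are
computed there, and evaluation at each `y` is a ring homomorphism, hence commutes with both. -/
theorem mem_regAt_matrix_inverse {n : Type*} [Fintype n] [DecidableEq n] {x : V}
    {M : V → Matrix n n ℂ} (hM : ∀ i j, (fun y => M y i j) ∈ regAt x) :
    (fun y => (M y).det) ∈ regAt x ∧ ∀ i j, (fun y => (M y).adjugate i j) ∈ regAt x := by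
  let M' : Matrix n n (regAt x) := fun i j => ⟨_, hM i j⟩
  let ev : V → regAt x →+* ℂ := fun y => (Pi.evalRingHom (fun _ : V => ℂ) y).comp
    (regAt x).val.toRingHom
  have e : ∀ y, (ev y).mapMatrix M' = M y := fun y => rfl
  constructor
  · convert M'.det.2 using 1
    ext y
    rw [← e, ← RingHom.map_det]
    rfl
  · intro i j
    convert (M'.adjugate i j).2 using 1
    ext y
    rw [← e, ← RingHom.map_adjugate]
    rfl

/-- A linear system with regular coefficients which is uniquely solvable at a point has a regular
solution near this point. -/
theorem exists_regular_solution [FiniteDimensional ℂ E] {x : V} {F : V → E →ₗ[ℂ] E}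
    (hF : ∀ e, IsRegAt x (fun y => F y e)) (hx : Function.Injective (F x)) (v : E) :
    ∃ N : V → E, IsRegAt x N ∧ ∀ᶠ y in zNhds x, Function.Injective (F y) ∧ F y (N y) = v := by
  let b := Module.finBasis ℂ E
  let M : V → Matrix _ _ ℂ := fun y => LinearMap.toMatrix b b (F y)
  obtain ⟨h1, h2⟩ := mem_regAt_matrix_inverse (x := x) (M := M) fun i j => by
    simp only [M, LinearMap.toMatrix_apply]
    exact hF (b j) (b.coord i)
  have hdet : ∀ y, (M y).det = LinearMap.det (F y) := fun y => LinearMap.det_toMatrix b (F y)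
  have hdx : (M x).det ≠ 0 := by
    rw [hdet]
    exact ((LinearMap.isUnit_iff_ker_eq_bot _).2 (LinearMap.ker_eq_bot.2 hx)).map
      LinearMap.det |>.ne_zero
  -- Cramer's rule: `N y = det⁻¹ • adj (M y) v`, in coordinates.
  refine ⟨fun y => (M y).det⁻¹ • ∑ i, ∑ j, ((M y).adjugate i j * b.coord j v) • b i,
    IsRegAt.smul (inv_mem_regAt h1 hdx) (IsRegAt.sum fun i _ => IsRegAt.sum fun j _ =>
      IsRegAt.smul (mul_mem (h2 i j) (Subalgebra.algebraMap_mem _ (b.coord j v)))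
        (isRegAt_const x (b i))), ?_⟩
  filter_upwards [eventually_ne_zero h1 hdx] with y hy
  constructor
  · rw [hdet] at hy
    exact LinearMap.ker_eq_bot.1 ((LinearMap.isUnit_iff_ker_eq_bot _).1
      ((LinearMap.isUnit_iff_isUnit_det _).2 (isUnit_iff_ne_zero.2 hy)))
  · apply b.repr.injective
    have h3 : ∑ i, ∑ j, ((M y).adjugate i j * b.coord j v) • b i =
        b.equivFun.symm ((M y).adjugate.mulVec (b.equivFun v)) := by
      simp [Module.Basis.equivFun_symm_apply, Matrix.mulVec, dotProduct, Finset.sum_smul]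
    ext i
    rw [h3, map_smul, map_smul]
    have h4 := LinearMap.toMatrix_mulVec_repr b b (F y)
      (b.equivFun.symm ((M y).adjugate.mulVec (b.equivFun v)))
    have h5 := congrFun h4 i
    rw [Finsupp.smul_apply, ← h5]
    change (M y).det⁻¹ * ((M y).mulVec (b.equivFun _)) i = _
    rw [LinearEquiv.apply_symm_apply, Matrix.mulVec_mulVec, Matrix.mul_adjugate]
    simp [hy, Matrix.smul_mulVec]

/-- In a regular family of linear maps of constant rank, every element of a kernel extends to a
regular family of elements of the kernels. -/
theorem exists_regular_kernel_section [FiniteDimensional ℂ E] [FiniteDimensional ℂ E'] {x : V}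
    {S : Set V} {T : V → E →ₗ[ℂ] E'} (hT : ∀ e, IsRegAt x (fun y => T y e))
    (hS : ∀ y ∈ S, Module.finrank ℂ (LinearMap.range (T y)) =
      Module.finrank ℂ (LinearMap.range (T x))) {v : E} (hv : T x v = 0) :
    ∃ N : V → E, IsRegAt x N ∧ N x = v ∧ ∀ᶠ y in zNhds x, y ∈ S → T y (N y) = 0 := by
  -- The extension `τ` of `σ` to all of `E'` is a generalized inverse: `T x ∘ τ ∘ T x = T x`.
  obtain ⟨σ, hσ⟩ := (T x).rangeRestrict.exists_rightInverse_of_surjective (T x).range_rangeRestrict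
  obtain ⟨τ, hτ⟩ := LinearMap.exists_extend σ
  have hτ' : ∀ w, T x (τ (T x w)) = T x w := fun w => by
    have h1 := LinearMap.congr_fun hτ ((T x).rangeRestrict w)
    have h2 := LinearMap.congr_fun hσ ((T x).rangeRestrict w)
    change τ (T x w) = _ at h1
    rw [h1]
    exact congrArg Subtype.val h2
  -- The correction `F y` is the identity at `y = x` and satisfies `T x ∘ F y = T x ∘ τ ∘ T y`. Near
  -- `x` it is invertible and carries the kernel of `T y` into that of `T x`; constant rank makes
  -- this a bijection of kernels, so the solution of `F y (N y) = v` lies in the kernel of `T y`.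
  let F : V → E →ₗ[ℂ] E := fun y => LinearMap.id + τ ∘ₗ (T y - T x)
  have hF : ∀ e, IsRegAt x (fun y => F y e) := fun e =>
    (isRegAt_const x e).add (((hT e).sub (isRegAt_const x (T x e))).linear τ)
  have hFx : F x = LinearMap.id := by simp [F]
  have hTF : ∀ y w, T x (F y w) = T x (τ (T y w)) := fun y w => by simp [F, hτ']
  obtain ⟨N, hN, h⟩ := exists_regular_solution hF (by rw [hFx]; exact fun _ _ h => h) v
  refine ⟨N, hN, ?_, ?_⟩
  · have := (self_mem_of_mem_zNhds h).2
    rwa [hFx] at this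
  filter_upwards [h] with y ⟨hinj, hy⟩ hyS
  have hle : LinearMap.ker (T y) ≤ LinearMap.ker (T x ∘ₗ F y) := fun w hw => by
    rw [LinearMap.mem_ker] at hw ⊢
    rw [LinearMap.comp_apply, hTF, hw, map_zero, map_zero]
  have hrange : LinearMap.range (T x ∘ₗ F y) = LinearMap.range (T x) :=
    LinearMap.range_comp_of_range_eq_top _
      (LinearMap.range_eq_top.2 (LinearMap.injective_iff_surjective.1 hinj))
  have heq := Submodule.eq_of_le_of_finrank_eq hle (by
    have h1 := (T y).finrank_range_add_finrank_ker
    have h2 := (T x ∘ₗ F y).finrank_range_add_finrank_ker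
    rw [hrange] at h2
    have h3 := hS y hyS
    omega)
  have : N y ∈ LinearMap.ker (T x ∘ₗ F y) := by
    rw [LinearMap.mem_ker, LinearMap.comp_apply, hy, hv]
  rwa [← heq] at this

end Regular

/-! ### Translation to products in the associative algebra, the trace form and coefficient formulas.
-/

section Algebra

variable {m r : ℕ}

instance : FiniteDimensional ℂ (Takiff m r) :=
  inferInstanceAs (FiniteDimensional ℂ (Fin (r + 1) → Fin m → Fin m → ℂ))

instance : FiniteDimensional ℂ (TakiffDual m r) :=
  inferInstanceAs (FiniteDimensional ℂ (Fin (r + 1) → Fin m → Fin m → ℂ))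

instance : IsScalarTower ℂ (Takiff m r) (Takiff m r) :=
  ⟨fun c g h => by ext1 k; simp [Takiff.coeff_mul, Finset.smul_sum]⟩

instance : SMulCommClass ℂ (Takiff m r) (Takiff m r) :=
  ⟨fun c g h => by ext1 k; simp [Takiff.coeff_mul, Finset.smul_sum]⟩

/-- Multiplication of the Takiff algebra as a bilinear map. -/
noncomputable def mulBilin (m r : ℕ) : Takiff m r →ₗ[ℂ] Takiff m r →ₗ[ℂ] Takiff m r := LinearMap.mul ℂ _

@[simp] theorem mulBilin_apply (g h : Takiff m r) : mulBilin m r g h = g * h := rfl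

/-- Multiplication by `z ^ (r+1)` as a linear isomorphism. -/
def shiftEquiv (m r : ℕ) : TakiffDual m r ≃ₗ[ℂ] Takiff m r where
  toFun A := A.shift
  invFun B := fun i => B i.rev
  map_add' _ _ := rfl
  map_smul' _ _ := rfl
  left_inv A := by
    ext1 i
    exact congrArg A (Fin.rev_rev i)
  right_inv B := by
    ext1 i
    exact congrArg B (Fin.rev_rev i)

@[simp] theorem shift_symm (B : Takiff m r) : ((shiftEquiv m r).symm B).shift = B :=
  (shiftEquiv m r).apply_symm_apply B

@[simp] theorem shift_add (A B : TakiffDual m r) : (A + B).shift = A.shift + B.shift := rfl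
@[simp] theorem shift_zero : (0 : TakiffDual m r).shift = 0 := rfl
@[simp] theorem shift_neg (A : TakiffDual m r) : (-A).shift = -A.shift := rfl

theorem shift_eq_zero {A : TakiffDual m r} : A.shift = 0 ↔ A = 0 :=
  (shiftEquiv m r).map_eq_zero_iff

theorem coeff_shift (A : TakiffDual m r) (i : Fin (r + 1)) : A.shift.coeff i = A.coeff i.rev := rfl

theorem coeff_eq_shift (A : TakiffDual m r) (i : Fin (r + 1)) :
    A.coeff i = A.shift.coeff i.rev := by
  rw [coeff_shift, Fin.rev_rev]

theorem shift_piMinus_mul_right (A : TakiffDual m r) (h : Takiff m r) :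
    (piMinus r (A.toLaurent * h.toLaurent)).shift = A.shift * h := by
  simpa [Takiff.toLaurent_one] using shift_piMinus_mul_mul 1 A h

theorem shift_momentInner (x : PhaseSpace m r) : (momentInner x).shift = x.P.shift * x.Q :=
  shift_piMinus_mul_right _ _

theorem shift_matA (x : PhaseSpace m r) : (matA x).shift = x.Q * x.P.shift :=
  shift_piMinus_mul _ _

theorem shift_coadjoint (g : TakiffGroup m r) (A : TakiffDual m r) :
    (g • A).shift = g * A.shift * (g⁻¹ : TakiffGroup m r) :=
  shift_piMinus_mul_mul _ _ _

theorem shift_coad (A : TakiffDual m r) (ξ : Takiff m r) :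
    (coad A ξ).shift = ξ * A.shift - A.shift * ξ := by
  have : (coad A ξ).shift = (piMinus r (ξ.toLaurent * A.toLaurent)).shift -
    (piMinus r (A.toLaurent * ξ.toLaurent)).shift := rfl
  rw [this, shift_piMinus_mul, shift_piMinus_mul_right]

theorem Q_smul (g : TakiffGroup m r) (x : PhaseSpace m r) :
    (g • x).Q = x.Q * (g⁻¹ : TakiffGroup m r) := rfl

theorem shift_P_smul (g : TakiffGroup m r) (x : PhaseSpace m r) :
    (g • x).P.shift = g * x.P.shift := shift_piMinus_mul _ _

theorem Q_innerInf (x : PhaseSpace m r) (ξ : Takiff m r) : (innerInf x ξ).Q = -(x.Q * ξ) := rfl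

theorem shift_P_innerInf (x : PhaseSpace m r) (ξ : Takiff m r) :
    (innerInf x ξ).P.shift = ξ * x.P.shift := shift_piMinus_mul _ _

/-- The trace of the coefficient of `z ^ r`. -/
def traceForm (m r : ℕ) : Takiff m r →ₗ[ℂ] ℂ where
  toFun g := (g.coeff (Fin.last r)).trace
  map_add' g h := by simp
  map_smul' c g := by simp

theorem traceForm_mul_comm (g h : Takiff m r) :
    traceForm m r (g * h) = traceForm m r (h * g) := by
  change ((g * h).coeff _).trace = ((h * g).coeff _).trace
  rw [Takiff.coeff_mul, Takiff.coeff_mul, Finset.sum_comm]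
  simp only [Matrix.trace_sum]
  refine Finset.sum_congr rfl fun i _ => Finset.sum_congr rfl fun j _ => ?_
  rw [add_comm (i : ℕ)]
  split_ifs
  · exact Matrix.trace_mul_comm _ _
  · rfl

/-- The shift moves `A i` to the power `z ^ (r-i)`, so the coefficient of `z ^ r` in the product
collects exactly the terms `A i * B i`. -/
theorem pairing_eq_traceForm (A : TakiffDual m r) (B : Takiff m r) :
    pairing A B = traceForm m r (A.shift * B) := by
  change _ = ((A.shift * B).coeff _).trace
  rw [Takiff.coeff_mul, Finset.sum_comm, Matrix.trace_sum]
  refine Finset.sum_congr rfl fun j _ => ?_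
  rw [Finset.sum_eq_single j.rev]
  · rw [if_pos, coeff_shift, Fin.rev_rev]
    simp only [Fin.val_rev, Fin.val_last]
    omega
  · intro i _ hi
    refine if_neg fun h => hi (Fin.ext ?_)
    simp only [Fin.val_rev, Fin.val_last] at h ⊢
    omega
  · exact fun h => absurd (Finset.mem_univ _) h

open scoped ComplexOrder in
theorem eq_zero_of_pairing_eq_zero {A : TakiffDual m r} (h : ∀ B, pairing A B = 0) : A = 0 := by
  ext1 i
  -- Testing against the conjugate transpose of one coefficient gives `Tr (X Xᴴ) = 0`, which forces
  -- `X = 0`.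
  have h1 := h (fun j => if j = i then (A.coeff i).conjTranspose else 0)
  unfold pairing at h1
  rw [Finset.sum_eq_single i] at h1
  · change (A.coeff i * (if i = i then _ else _)).trace = 0 at h1
    rw [if_pos rfl] at h1
    exact Matrix.trace_mul_conjTranspose_self_eq_zero_iff.1 h1
  · intro j _ hj
    change (A.coeff j * (if j = i then _ else _)).trace = 0
    simp [hj]
  · exact fun h => absurd (Finset.mem_univ _) h

theorem omega_eq_traceForm (u v : PhaseSpace m r) :
    omega u v = traceForm m r (u.P.shift * v.Q) - traceForm m r (v.P.shift * u.Q) := by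
  rw [omega, pairing_eq_traceForm, pairing_eq_traceForm]

theorem val_lt_succ (k : Fin (r + 1)) (i : Fin (r - k + 1)) : (i : ℕ) < r + 1 := by omega

theorem val_add_lt_succ (k : Fin (r + 1)) (i : Fin (r - k + 1)) : (i + k : ℕ) < r + 1 := by omega

/-- The condition `i + j = r - k` means that `r - j = i + k`, so the surviving terms are indexed by
`i ≤ r - k`. -/
theorem sum_antidiagonal_rev {M : Type*} [AddCommMonoid M] (f : Fin (r + 1) → Fin (r + 1) → M)
    (k : Fin (r + 1)) :
    (∑ i : Fin (r + 1), ∑ j : Fin (r + 1), if (i : ℕ) + j = k.rev then f i j.rev else 0) =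
      ∑ i : Fin (r - k + 1), f ⟨i, val_lt_succ k i⟩ ⟨i + k, val_add_lt_succ k i⟩ := by
  symm
  refine Fintype.sum_of_injective (fun i : Fin (r - k + 1) => (⟨i, val_lt_succ k i⟩ : Fin (r + 1)))
    (fun a b h => by simpa [Fin.ext_iff] using h) _ _ (fun i hi => ?_) (fun i => ?_)
  · refine Finset.sum_eq_zero fun j _ => if_neg fun h => hi ⟨⟨i, ?_⟩, rfl⟩
    simp only [Fin.val_rev] at h
    omega
  · rw [Finset.sum_eq_single (⟨i + k, val_add_lt_succ k i⟩ : Fin (r + 1)).rev]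
    · rw [if_pos, Fin.rev_rev]
      simp only [Fin.val_rev]
      omega
    · intro j _ hj
      refine if_neg fun h => hj (Fin.ext ?_)
      simp only [Fin.val_rev] at h ⊢
      omega
    · exact fun h => absurd (Finset.mem_univ _) h

theorem coeff_matA (x : PhaseSpace m r) (k : Fin (r + 1)) :
    (matA x).coeff k =
      ∑ i : Fin (r - k + 1), x.Q.coeff ⟨i, val_lt_succ k i⟩ * x.P.coeff ⟨i + k, val_add_lt_succ k i⟩ := by
  rw [coeff_eq_shift, shift_matA, Takiff.coeff_mul]
  exact sum_antidiagonal_rev (fun i j => x.Q.coeff i * x.P.coeff j) k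

theorem coeff_momentInner (x : PhaseSpace m r) (k : Fin (r + 1)) :
    (momentInner x).coeff k =
      ∑ i : Fin (r - k + 1), x.P.coeff ⟨i + k, val_add_lt_succ k i⟩ * x.Q.coeff ⟨i, val_lt_succ k i⟩ := by
  rw [coeff_eq_shift, shift_momentInner, Takiff.coeff_mul, Finset.sum_comm]
  simp only [fun i j : Fin (r + 1) => add_comm (i : ℕ) (j : ℕ)]
  exact sum_antidiagonal_rev (fun i j => x.P.coeff j * x.Q.coeff i) k

end Algebra

/-! ### Differentials of the moment maps, and the inner action. -/

section Differential

theorem fderiv_bilinear_apply {E F G : Type*} [NormedAddCommGroup E] [NormedSpace ℂ E]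
    [FiniteDimensional ℂ E] [NormedAddCommGroup F] [NormedSpace ℂ F] [FiniteDimensional ℂ F]
    [NormedAddCommGroup G] [NormedSpace ℂ G] (B : E →ₗ[ℂ] F →ₗ[ℂ] G) (p v : E × F) :
    fderiv ℂ (fun q : E × F => B q.1 q.2) p v = B v.1 p.2 + B p.1 v.2 := by
  let B' : E →L[ℂ] F →L[ℂ] G := LinearMap.toContinuousLinearMap
    ((LinearMap.toContinuousLinearMap (𝕜 := ℂ) (E := F) (F' := G)).toLinearMap ∘ₗ B)
  have h := B'.hasFDerivAt_of_bilinear (hasFDerivAt_fst (𝕜 := ℂ) (p := p)) hasFDerivAt_snd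
  change (fderiv ℂ (fun q : E × F => B' q.1 q.2) p) v = _
  rw [h.fderiv]
  change B p.1 v.2 + B v.1 p.2 = _
  exact add_comm _ _

variable {m r : ℕ}

/-- The phase space carries only a topology. Unfolding to function spaces, where a norm inducing the
same topology is available, reduces this to the normed case. -/
theorem fderiv_phaseSpace_apply (B : Takiff m r →ₗ[ℂ] TakiffDual m r →ₗ[ℂ] TakiffDual m r)
    (x v : PhaseSpace m r) :
    fderiv ℂ (fun y : PhaseSpace m r => B y.Q y.P) x v = B v.Q x.P + B x.Q v.P :=
  fderiv_bilinear_apply (E := Fin (r + 1) → Fin m → Fin m → ℂ)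
    (F := Fin (r + 1) → Fin m → Fin m → ℂ) (G := Fin (r + 1) → Fin m → Fin m → ℂ) B x v

theorem shift_dA (x v : PhaseSpace m r) :
    (dA x v).shift = v.Q * x.P.shift + x.Q * v.P.shift := by
  let B : Takiff m r →ₗ[ℂ] TakiffDual m r →ₗ[ℂ] TakiffDual m r :=
    ((mulBilin m r).compl₂ (shiftEquiv m r).toLinearMap).compr₂ (shiftEquiv m r).symm.toLinearMap
  have hB : (matA : PhaseSpace m r → _) = fun y => B y.Q y.P := by
    ext1 y
    apply TakiffDual.shift_injective
    rw [shift_matA]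
    exact (shift_symm _).symm
  have := fderiv_phaseSpace_apply B x v
  rw [← hB] at this
  rw [dA]
  refine (congrArg TakiffDual.shift this).trans ?_
  rw [shift_add]
  exact congrArg₂ _ (shift_symm _) (shift_symm _)

theorem shift_dMoment (x v : PhaseSpace m r) :
    (dMoment x v).shift = x.P.shift * v.Q + v.P.shift * x.Q := by
  let B : Takiff m r →ₗ[ℂ] TakiffDual m r →ₗ[ℂ] TakiffDual m r :=
    ((mulBilin m r).flip.compl₂ (shiftEquiv m r).toLinearMap).compr₂
      (shiftEquiv m r).symm.toLinearMap
  have hB : (momentInner : PhaseSpace m r → _) = fun y => B y.Q y.P := by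
    ext1 y
    apply TakiffDual.shift_injective
    rw [shift_momentInner]
    exact (shift_symm _).symm
  have := fderiv_phaseSpace_apply B x v
  rw [← hB] at this
  rw [dMoment]
  refine (congrArg TakiffDual.shift this).trans ?_
  rw [shift_add]
  exact congrArg₂ _ (shift_symm _) (shift_symm _)

theorem innerActionIsHamiltonian (m r : ℕ) : InnerActionIsHamiltonian m r where
  symplectic g u v := by
    have h : ∀ u v : PhaseSpace m r, traceForm m r ((g • u).P.shift * (g • v).Q) =
        traceForm m r (u.P.shift * v.Q) := fun u v => by
      rw [shift_P_smul, Q_smul, ← mul_assoc, traceForm_mul_comm]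
      simp [← mul_assoc]
    rw [omega_eq_traceForm, omega_eq_traceForm, h, h]
  moment ξ x v := by
    rw [omega_eq_traceForm, pairing_eq_traceForm, shift_dMoment, Q_innerInf, shift_P_innerInf,
      mul_assoc, traceForm_mul_comm, mul_neg, map_neg, sub_neg_eq_add, add_mul, map_add]
    simp only [mul_assoc]
  equivariant g x := by
    apply TakiffDual.shift_injective
    rw [shift_coadjoint, shift_momentInner, shift_momentInner, shift_P_smul, Q_smul]
    simp only [mul_assoc]

end Differential

/-! ### The KKS form, and the reduced form computed through the outer action. -/

section Symplectic

variable {m r : ℕ}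

theorem pairing_commutator (A : TakiffDual m r) (ξ η : Takiff m r) :
    pairing A (ξ * η - η * ξ) = -pairing (coad A ξ) η := by
  simp only [pairing_eq_traceForm, shift_coad, mul_sub, sub_mul, map_sub, ← mul_assoc]
  rw [← traceForm_mul_comm ξ]
  simp only [← mul_assoc]
  ring

/-- The form is `K B C = ⟨B, σ C⟩`, where `σ` picks some `ξ` with `ad*_ξ A = C`. Antisymmetry of
`⟨ad*_ξ A, η⟩` in `ξ` and `η` makes the value independent of the choice, and nondegeneracy of the
trace pairing gives that of `K`. -/
theorem exists_isKKSForm (A : TakiffDual m r) :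
    ∃ K : LinearMap.BilinForm ℂ (orbitTangent A), IsKKSForm A K ∧ K.Nondegenerate := by
  obtain ⟨σ, hσ⟩ := (coad A).rangeRestrict.exists_rightInverse_of_surjective
    (coad A).range_rangeRestrict
  have hσ' : ∀ C : orbitTangent A, coad A (σ C) = C := fun C =>
    congrArg Subtype.val (LinearMap.congr_fun hσ C)
  have hsymm : ∀ ξ η, pairing (coad A ξ) η = -pairing (coad A η) ξ := fun ξ η => by
    have h1 := pairing_commutator A ξ η
    have h2 := pairing_commutator A η ξ
    have h3 : pairing A (ξ * η - η * ξ) = -pairing A (η * ξ - ξ * η) := by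
      simp only [pairing_eq_traceForm, mul_sub, map_sub]
      ring
    rw [h1, h2] at h3
    linear_combination -h3
  let K : LinearMap.BilinForm ℂ (orbitTangent A) :=
    ((mulBilin m r).compr₂ (traceForm m r)).compl₁₂
      ((shiftEquiv m r).toLinearMap ∘ₗ (orbitTangent A).subtype) σ
  have hK : ∀ B C, K B C = pairing B.1 (σ C) := fun B C => (pairing_eq_traceForm _ _).symm
  have hK' : ∀ (B : orbitTangent A) (η : Takiff m r),
      K B ⟨coad A η, η, rfl⟩ = pairing B.1 η := fun B η => by
    -- With `B = ad*_(σ B) A`, antisymmetry moves the chosen preimage inside `coad`, where only its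
    -- image matters.
    rw [hK, ← hσ' B, hsymm, hσ', hsymm (σ B)]
  have hswap : ∀ B C, K B C = -K C B := fun B C => by
    have h := hsymm (σ B) (σ C)
    rw [hσ', hσ'] at h
    rw [hK, hK, h]
  have hleft : K.SeparatingLeft := fun B hB => Subtype.ext
    (eq_zero_of_pairing_eq_zero fun η => by rw [← hK', hB])
  refine ⟨K, fun ξ η => ?_, hleft, fun B hB => hleft B fun C => ?_⟩
  · rw [hK', pairing_commutator, neg_neg]
  · rw [hswap, hB, neg_zero]

/-- The infinitesimal outer action `ξ ↦ (ξ Q mod z ^ (r+1), -π₋[P ξ])`. -/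
noncomputable def outerInf (x : PhaseSpace m r) : Takiff m r →ₗ[ℂ] PhaseSpace m r :=
  LinearMap.prod ((mulBilin m r).flip x.Q)
    (-((shiftEquiv m r).symm.toLinearMap ∘ₗ mulBilin m r x.P.shift))

theorem Q_outerInf (x : PhaseSpace m r) (ξ : Takiff m r) : (outerInf x ξ).Q = ξ * x.Q := rfl

theorem shift_P_outerInf (x : PhaseSpace m r) (ξ : Takiff m r) :
    (outerInf x ξ).P.shift = -(x.P.shift * ξ) := by
  change (-((shiftEquiv m r).symm _)).shift = _
  rw [shift_neg, shift_symm]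
  rfl

/-- The point `(Q, P)` of the phase space, given by `Q` and `z ^ (r+1) P`. -/
noncomputable def PhaseSpace.mk (q p : Takiff m r) : PhaseSpace m r := (q, (shiftEquiv m r).symm p)

@[simp] theorem PhaseSpace.Q_mk (q p : Takiff m r) : (PhaseSpace.mk q p).Q = q := rfl

@[simp] theorem PhaseSpace.shift_P_mk (q p : Takiff m r) : (PhaseSpace.mk q p).P.shift = p :=
  shift_symm p

theorem phaseSpace_ext {x y : PhaseSpace m r} (hQ : x.Q = y.Q) (hP : x.P.shift = y.P.shift) :
    x = y :=
  PhaseSpace.ext hQ (TakiffDual.shift_injective hP)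

theorem dMoment_outerInf (x : PhaseSpace m r) (ξ : Takiff m r) :
    dMoment x (outerInf x ξ) = 0 := by
  apply TakiffDual.shift_injective
  rw [shift_dMoment, Q_outerInf, shift_P_outerInf, shift_zero]
  noncomm_ring

theorem dA_outerInf (x : PhaseSpace m r) (ξ : Takiff m r) :
    dA x (outerInf x ξ) = coad (matA x) ξ := by
  apply TakiffDual.shift_injective
  rw [shift_dA, Q_outerInf, shift_P_outerInf, shift_coad, shift_matA]
  noncomm_ring

/-- Cyclicity of the trace turns `p ζ q` into `q p ζ`, so only `A = q p` enters. This is the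
identity that matches the reduced form with the KKS form. -/
theorem omega_outerInf (x : PhaseSpace m r) (ξ η : Takiff m r) :
    omega (outerInf x ξ) (outerInf x η) = -pairing (matA x) (ξ * η - η * ξ) := by
  have h : ∀ ζ, traceForm m r (x.P.shift * ζ * x.Q) = traceForm m r (x.Q * x.P.shift * ζ) :=
    fun ζ => by rw [traceForm_mul_comm, mul_assoc]
  rw [omega_eq_traceForm, pairing_eq_traceForm, Q_outerInf, Q_outerInf, shift_P_outerInf,
    shift_P_outerInf, shift_matA, mul_sub, map_sub, neg_mul, neg_mul, map_neg, map_neg, ← h, ← h]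
  simp only [mul_assoc]
  ring

/-- The points where `Q(z)` or `z ^ (r+1) P(z)` is invertible. -/
def IsNondegeneratePoint (x : PhaseSpace m r) : Prop := IsUnit x.Q ∨ IsUnit x.P.shift

theorem surjective_dMoment {x : PhaseSpace m r} (hx : IsNondegeneratePoint x) :
    Function.Surjective (dMoment x) := by
  intro B
  rcases hx with ⟨g, hg⟩ | ⟨g, hg⟩
  · refine ⟨PhaseSpace.mk 0 (B.shift * (g⁻¹ : TakiffGroup m r)), ?_⟩
    apply TakiffDual.shift_injective
    rw [shift_dMoment, ← hg]
    simp
  · refine ⟨PhaseSpace.mk ((g⁻¹ : TakiffGroup m r) * B.shift) 0, ?_⟩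
    apply TakiffDual.shift_injective
    rw [shift_dMoment, ← hg]
    simp

/-- The invertible component of `x` determines `ξ` from the corresponding component of `v`; the
linearized equation `p v_Q + v_P q = 0` then forces the other component to agree. -/
theorem exists_outerInf_eq {x : PhaseSpace m r} (hx : IsNondegeneratePoint x)
    {v : PhaseSpace m r} (hv : dMoment x v = 0) : ∃ ξ, outerInf x ξ = v := by
  rw [← shift_eq_zero, shift_dMoment] at hv
  rcases hx with ⟨g, hg⟩ | ⟨g, hg⟩
  · refine ⟨v.Q * (g⁻¹ : TakiffGroup m r), phaseSpace_ext ?_ ?_⟩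
    · rw [Q_outerInf, ← hg]
      simp
    · rw [shift_P_outerInf, ← mul_assoc, eq_neg_of_add_eq_zero_left hv, ← hg]
      simp [mul_assoc]
  · refine ⟨-((g⁻¹ : TakiffGroup m r) * v.P.shift), phaseSpace_ext ?_ ?_⟩
    · rw [Q_outerInf, neg_mul, mul_assoc, eq_neg_of_add_eq_zero_right hv, ← hg]
      simp
    · rw [shift_P_outerInf, ← hg]
      simp

/-- Conjugation by the invertible component carries the commutant of `q p` to that of `p q`. The
outer vector of `ξ` is therefore the inner vector of `-q⁻¹ ξ q`, respectively `-p ξ p⁻¹`, which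
stabilizes `Λ`. -/
theorem outerInf_mem_stabTangent {x : PhaseSpace m r} (hx : IsNondegeneratePoint x)
    {ξ : Takiff m r} (hξ : coad (matA x) ξ = 0) : outerInf x ξ ∈ stabTangent x := by
  rw [← shift_eq_zero, shift_coad, shift_matA, sub_eq_zero] at hξ
  rcases hx with ⟨g, hg⟩ | ⟨g, hg⟩
  · have h : ξ * g * x.P.shift = g * x.P.shift * ξ := by rw [hg, mul_assoc, hξ]
    refine ⟨-((g⁻¹ : TakiffGroup m r) * ξ * g), ?_, phaseSpace_ext ?_ ?_⟩
    · rw [SetLike.mem_coe, LinearMap.mem_ker, ← shift_eq_zero, shift_coad, shift_momentInner,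
        ← hg]
      have h' := congrArg (· * (g : Takiff m r)) h
      simp only [mul_assoc] at h'
      simp [mul_assoc, h']
    · rw [Q_innerInf, Q_outerInf, ← hg]
      simp [mul_assoc]
    · rw [shift_P_innerInf, shift_P_outerInf]
      rw [mul_assoc] at h
      simp [mul_assoc, h]
  · have h : ξ * (x.Q * g) = x.Q * g * ξ := by rw [hg, hξ]
    refine ⟨-(g * ξ * (g⁻¹ : TakiffGroup m r)), ?_, phaseSpace_ext ?_ ?_⟩
    · rw [SetLike.mem_coe, LinearMap.mem_ker, ← shift_eq_zero, shift_coad, shift_momentInner,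
        ← hg]
      have h' : ξ * x.Q = x.Q * (g * (ξ * (g⁻¹ : TakiffGroup m r))) := by
        rw [← mul_assoc, ← mul_assoc, ← h]
        simp [mul_assoc]
      simp [mul_assoc, h']
    · rw [Q_innerInf, Q_outerInf]
      have h' : ξ * x.Q = x.Q * (g * (ξ * (g⁻¹ : TakiffGroup m r))) := by
        rw [← mul_assoc, ← mul_assoc, ← h]
        simp [mul_assoc]
      simp [mul_assoc, h']
    · rw [shift_P_innerInf, shift_P_outerInf, ← hg]
      simp [mul_assoc]

theorem dA_eq_zero_of_mem_stabTangent {x v : PhaseSpace m r} (hv : v ∈ stabTangent x) :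
    dA x v = 0 := by
  obtain ⟨ξ, -, rfl⟩ := hv
  rw [← shift_eq_zero, shift_dA, Q_innerInf, shift_P_innerInf]
  noncomm_ring

/-- The differential of `A` on the level tangent space is onto the orbit tangent space with kernel
the stabilizer directions, so it descends to an isomorphism `Φ`. Taking `Ω` to be the pull-back of
`K` along `Φ` makes compatibility and nondegeneracy automatic; that `Ω` comes from `omega` is
checked on outer vectors. -/
theorem exists_reducedForm {x : PhaseSpace m r} (hx : IsNondegeneratePoint x) :
    ∃ (Ω : LinearMap.BilinForm ℂ (reducedTangent x))
      (K : LinearMap.BilinForm ℂ (orbitTangent (matA x)))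
      (Φ : reducedTangent x ≃ₗ[ℂ] orbitTangent (matA x)),
      IsReducedForm x Ω ∧ Ω.Nondegenerate ∧ IsKKSForm (matA x) K ∧ K.Nondegenerate ∧
      (∀ u : levelTangent x, (Φ (Submodule.Quotient.mk u) : TakiffDual m r) = dA x u.1) ∧
      ∀ a b : reducedTangent x, K (Φ a) (Φ b) = Ω a b := by
  obtain ⟨K, hK, hKn⟩ := exists_isKKSForm (matA x)
  have hrep : ∀ u : levelTangent x, ∃ ξ, outerInf x ξ = u.1 := fun u => exists_outerInf_eq hx u.2
  let φ : levelTangent x →ₗ[ℂ] orbitTangent (matA x) :=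
    (dA x ∘ₗ (levelTangent x).subtype).codRestrict _ fun u => by
      obtain ⟨ξ, hξ⟩ := hrep u
      exact ⟨ξ, by rw [LinearMap.comp_apply, Submodule.subtype_apply, ← hξ, dA_outerInf]⟩
  have hφ : ∀ u, (φ u : TakiffDual m r) = dA x u.1 := fun u => rfl
  have hker : LinearMap.ker φ = (stabTangent x).comap (levelTangent x).subtype := by
    ext u
    rw [LinearMap.mem_ker, Submodule.mem_comap, Submodule.subtype_apply]
    constructor
    · intro h
      obtain ⟨ξ, hξ⟩ := hrep u
      have h' := congrArg Subtype.val h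
      rw [hφ, ← hξ, dA_outerInf] at h'
      rw [← hξ]
      exact outerInf_mem_stabTangent hx h'
    · exact fun h => Subtype.ext (dA_eq_zero_of_mem_stabTangent h)
  have hsurj : Function.Surjective φ := by
    rintro ⟨_, ξ, rfl⟩
    exact ⟨⟨outerInf x ξ, dMoment_outerInf x ξ⟩, Subtype.ext (dA_outerInf x ξ)⟩
  let Φ : reducedTangent x ≃ₗ[ℂ] orbitTangent (matA x) :=
    (Submodule.quotEquivOfEq _ _ hker.symm).trans (φ.quotKerEquivOfSurjective hsurj)
  have hΦ : ∀ u : levelTangent x, Φ (Submodule.Quotient.mk u) = φ u := fun u => rfl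
  refine ⟨LinearMap.BilinForm.congr Φ.symm K, K, Φ, fun u v => ?_, hKn.congr _, hK, hKn,
    fun u => rfl, fun a b => rfl⟩
  change K (Φ (Submodule.Quotient.mk u)) (Φ (Submodule.Quotient.mk v)) = _
  obtain ⟨ξ, hξ⟩ := hrep u
  obtain ⟨η, hη⟩ := hrep v
  rw [← hξ, ← hη, omega_outerInf, ← hK, hΦ, hΦ]
  congr 2 <;> ext1 <;> simp [hφ, ← hξ, ← hη, dA_outerInf]

end Symplectic

/-! ### Biregularity from local sections. -/

section Reduction

variable {m r : ℕ}

/-- `(Q, P) ↦ Q` as a linear map. -/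
def linQ (m r : ℕ) : PhaseSpace m r →ₗ[ℂ] Takiff m r where
  toFun x := x.Q
  map_add' _ _ := rfl
  map_smul' _ _ := rfl

/-- `(Q, P) ↦ z ^ (r+1) P` as a linear map. -/
def linP (m r : ℕ) : PhaseSpace m r →ₗ[ℂ] Takiff m r where
  toFun x := x.P.shift
  map_add' _ _ := rfl
  map_smul' _ _ := rfl

theorem isRegAt_matA (x : PhaseSpace m r) : IsRegAt x (matA (m := m) (r := r)) := by
  have h := (((isRegAt_id x).linear (linQ m r)).bilin (mulBilin m r)
    ((isRegAt_id x).linear (linP m r))).linear (shiftEquiv m r).symm.toLinearMap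
  convert h using 1
  ext1 y
  apply TakiffDual.shift_injective
  rw [shift_matA]
  exact (shift_symm _).symm

theorem IsRegAt.phaseSpace_mk {V : Type} [AddCommGroup V] [Module ℂ V] {a : V}
    {q p : V → Takiff m r} (hq : IsRegAt a q) (hp : IsRegAt a p) :
    IsRegAt a (fun y => PhaseSpace.mk (q y) (p y)) :=
  hq.prod (hp.linear (shiftEquiv m r).symm.toLinearMap)

theorem exists_regular_inverse {V : Type} [AddCommGroup V] [Module ℂ V] {a : V}
    {q : V → Takiff m r} (hq : IsRegAt a q) (hu : IsUnit (q a)) :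
    ∃ w : V → Takiff m r, IsRegAt a w ∧ ∀ᶠ y in zNhds a, q y * w y = 1 ∧ w y * q y = 1 := by
  obtain ⟨w, hw, h⟩ := exists_regular_solution (F := fun y => mulBilin m r (q y))
    (fun e => hq.linear ((mulBilin m r).flip e)) (fun _ _ h => hu.mul_left_cancel h) 1
  refine ⟨w, hw, h.mono fun y ⟨hinj, h1⟩ => ⟨h1, hinj ?_⟩⟩
  rw [mulBilin_apply] at h1
  -- A right inverse is two-sided here: `q (w q) = q = q * 1`, and left multiplication by `q` is
  -- injective.
  rw [mulBilin_apply, mulBilin_apply, ← mul_assoc, h1, one_mul, mul_one]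

theorem isOpen_isUnit (f : PhaseSpace m r →ₗ[ℂ] Takiff m r) :
    (affineSpace (PhaseSpace m r)).IsOpen {x | IsUnit (f x)} := fun x hx => by
  obtain ⟨w, -, h⟩ := exists_regular_inverse ((isRegAt_id x).linear f) hx
  exact h.mono fun y hy => isUnit_iff_exists.2 ⟨w y, hy⟩

/-- Open sets and regular functions pull back along the polynomial map `matA`. Conversely, near each
orbit point they are recovered by pulling back along the section `s`, which inverts the bijection
there. -/
theorem isBiregular_of_local_sections {L : TakiffDual m r} {D : Set (Reduction L)}
    (hmaps : Set.MapsTo (reducedMap L) D (MulAction.orbit (TakiffGroup m r) L))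
    (hinj : Set.InjOn (reducedMap L) D)
    (hsec : ∀ a ∈ MulAction.orbit (TakiffGroup m r) L, ∃ s : TakiffDual m r → PhaseSpace m r,
      IsRegAt a s ∧ ∀ᶠ y in zNhds a, y ∈ MulAction.orbit (TakiffGroup m r) L →
        ∃ h : s y ∈ levelSet L, Quotient.mk (reductionSetoid L) ⟨s y, h⟩ ∈ D ∧ matA (s y) = y) :
    IsBiregular ((reductionSpace L).sub D) (orbitSpace L)
      (Set.MapsTo.restrict (reducedMap L) D (MulAction.orbit (TakiffGroup m r) L) hmaps) where
  bijective := by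
    refine ⟨(Set.MapsTo.restrict_inj hmaps).2 hinj, fun a => ?_⟩
    obtain ⟨s, -, h⟩ := hsec a a.2
    obtain ⟨h1, h2, h3⟩ := self_mem_of_mem_zNhds h a.2
    exact ⟨⟨_, h2⟩, Subtype.ext h3⟩
  isOpen_iff U := by
    constructor
    · rintro ⟨W, hW, rfl⟩
      exact ⟨reducedMap L ⁻¹' W, ⟨matA ⁻¹' W, isOpen_preimage isRegAt_matA hW, rfl⟩, rfl⟩
    · rintro ⟨W, ⟨O, hO, hOW⟩, hWU⟩
      -- The ambient open set consists of the points with a Zariski neighbourhood all of whose orbit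
      -- points lie in `U`.
      refine ⟨_, isOpen_setOf_mem_zNhds {y | ∀ h, ⟨y, h⟩ ∈ U}, Set.ext fun a => ⟨fun ha => ?_,
        fun ha => self_mem_of_mem_zNhds ha a.2⟩⟩
      obtain ⟨s, hs, h⟩ := hsec a a.2
      have key : ∀ y ∈ MulAction.orbit (TakiffGroup m r) L, ∀ h : s y ∈ levelSet L,
          Quotient.mk (reductionSetoid L) ⟨s y, h⟩ ∈ D → matA (s y) = y → ∀ hy,
          ((⟨y, hy⟩ : MulAction.orbit (TakiffGroup m r) L) ∈ U ↔ s y ∈ O) := by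
        intro y _ h hD hA hy
        have h1 := Set.ext_iff.1 hWU ⟨_, hD⟩
        have h2 := Set.ext_iff.1 hOW ⟨s y, h⟩
        have h3 : Set.MapsTo.restrict (reducedMap L) D _ hmaps ⟨_, hD⟩ = ⟨y, hy⟩ :=
          Subtype.ext hA
        rw [Set.mem_preimage, h3] at h1
        exact h1.trans h2
      have hsO : s a ∈ O := by
        obtain ⟨h1, h2, h3⟩ := self_mem_of_mem_zNhds h a.2
        exact (key a a.2 h1 h2 h3 a.2).1 ha
      have hev : ∀ᶠ y in zNhds a.1, s y ∈ O := hs.tendsto (hO _ hsO)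
      change ∀ᶠ y in zNhds a.1, ∀ hy, (⟨y, hy⟩ : MulAction.orbit (TakiffGroup m r) L) ∈ U
      filter_upwards [h, hev] with y hy hyO hyL
      obtain ⟨h1, h2, h3⟩ := hy hyL
      exact (key y hyL h1 h2 h3 hyL).2 hyO
  isRegularOn_iff U _ f := by
    constructor
    · rintro hf ⟨d, hd⟩ hdU
      obtain ⟨W, hW, haW, h, hh, hfh⟩ := hf _ hdU
      refine ⟨reducedMap L ⁻¹' W, ⟨matA ⁻¹' W, isOpen_preimage isRegAt_matA hW, rfl⟩, haW,
        h ∘ reducedMap L, fun x hx => ⟨matA ⁻¹' W, isOpen_preimage isRegAt_matA hW, hx,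
        h ∘ matA, ?_, fun _ _ _ => rfl⟩, fun y hy hyW => hfh _ hy hyW⟩
      rw [isRegularOn_affineSpace (isOpen_preimage isRegAt_matA hW)]
      exact fun y hy => (isRegAt_matA y).comp_regAt ((isRegularOn_affineSpace hW).1 hh _ hy)
    · rintro hf ⟨a, ha⟩ haU
      obtain ⟨s, hs, hsa⟩ := hsec a ha
      have key : ∀ y (hy : y ∈ MulAction.orbit (TakiffGroup m r) L), ∀ h : s y ∈ levelSet L,
          ∀ hD : Quotient.mk (reductionSetoid L) ⟨s y, h⟩ ∈ D, matA (s y) = y →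
          Set.MapsTo.restrict (reducedMap L) D _ hmaps ⟨_, hD⟩ = ⟨y, hy⟩ :=
        fun y hy h hD hA => Subtype.ext hA
      obtain ⟨h1, h2, h3⟩ := self_mem_of_mem_zNhds hsa ha
      obtain ⟨W, ⟨O, hO, hOW⟩, hdW, h, hh, hfh⟩ := hf ⟨_, h2⟩
        (by rw [Set.mem_preimage, key a ha h1 h2 h3]; exact haU)
      obtain ⟨O', hO', haO', h', hh', hhh'⟩ := hh ⟨s a, h1⟩ hdW
      have hOW' : ∀ y (hy : s y ∈ levelSet L), Quotient.mk (reductionSetoid L) ⟨s y, hy⟩ ∈ W ↔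
        s y ∈ O := fun y hy => Set.ext_iff.1 hOW ⟨s y, hy⟩
      have hg : (fun y => h' (s y)) ∈ regAt a :=
        hs.comp_regAt ((isRegularOn_affineSpace hO').1 hh' _ haO')
      -- On `N` four things hold together: `h' ∘ s` is regular, `s` is a section over the orbit, and
      -- `s` lands in both `O` and `O'`.
      obtain ⟨N, hN, haN, hNo⟩ := exists_isOpen_of_mem_zNhds (inter_mem (inter_mem
        (eventually_mem_regAt hg) hsa) (inter_mem
          (hs.tendsto (hO _ ((hOW' a h1).1 hdW))) (hs.tendsto (hO' _ haO'))))
      refine ⟨N, hNo, haN, _, (isRegularOn_affineSpace hNo).2 fun y hy => (hN hy).1.1, ?_⟩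
      rintro ⟨y, hy⟩ hyU hyN
      obtain ⟨⟨-, hsy⟩, hyO, hyO'⟩ := hN hyN
      obtain ⟨k1, k2, k3⟩ := hsy hy
      have e := key y hy k1 k2 k3
      have hyW := (hOW' y k1).2 hyO
      rw [← hhh' ⟨s y, k1⟩ hyW hyO', ← e]
      exact hfh ⟨_, k2⟩ (by rw [Set.mem_preimage, e]; exact hyU) hyW

theorem isSymplectomorphismOn_of_local_sections {L : TakiffDual m r} {D : Set (Reduction L)}
    {U : Set (PhaseSpace m r)} (hU : (affineSpace (PhaseSpace m r)).IsOpen U)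
    (hD : ∀ x : levelSet L, Quotient.mk (reductionSetoid L) x ∈ D ↔ x.1 ∈ U)
    (hnondeg : ∀ x ∈ U, IsNondegeneratePoint x)
    (hmaps : ∀ x ∈ U, matA x ∈ MulAction.orbit (TakiffGroup m r) (momentInner x))
    (hinj : ∀ x ∈ U, ∀ y ∈ U, momentInner x = momentInner y → matA x = matA y →
      ∃ g : TakiffGroup m r, g • y = x)
    (hsec : ∀ a ∈ MulAction.orbit (TakiffGroup m r) L, ∃ s : TakiffDual m r → PhaseSpace m r,
      IsRegAt a s ∧ ∀ᶠ y in zNhds a, y ∈ MulAction.orbit (TakiffGroup m r) L →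
        momentInner (s y) = L ∧ s y ∈ U ∧ matA (s y) = y) :
    IsSymplectomorphismOn L D := by
  have hmaps' : Set.MapsTo (reducedMap L) D (MulAction.orbit (TakiffGroup m r) L) := by
    rintro d hd
    induction d using Quotient.inductionOn with | _ x =>
    have := hmaps x.1 ((hD x).1 hd)
    rwa [x.2] at this
  have hinj' : Set.InjOn (reducedMap L) D := by
    intro d hd e he hde
    induction d using Quotient.inductionOn with | _ x =>
    induction e using Quotient.inductionOn with | _ y =>
    obtain ⟨g, hg⟩ := hinj x ((hD x).1 hd) y ((hD y).1 he) (x.2.trans y.2.symm) hde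
    refine Quotient.sound ⟨⟨g, ?_⟩, hg⟩
    -- By equivariance, an element relating two points of the same level set fixes `L`, so it lies
    -- in the stabilizer.
    have := (innerActionIsHamiltonian m r).equivariant g y
    rw [hg, x.2, y.2] at this
    exact this.symm
  exact
  { isOpen := ⟨U, hU, Set.ext hD⟩
    nonempty := by
      obtain ⟨s, -, h⟩ := hsec L (MulAction.mem_orbit_self L)
      obtain ⟨h1, h2, -⟩ := self_mem_of_mem_zNhds h (MulAction.mem_orbit_self L)
      exact ⟨_, (hD ⟨s L, h1⟩).2 h2⟩
    mapsTo := hmaps'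
    isBiregular := isBiregular_of_local_sections hmaps' hinj' fun a ha => by
      obtain ⟨s, hs, h⟩ := hsec a ha
      refine ⟨s, hs, h.mono fun y hy hyL => ?_⟩
      obtain ⟨h1, h2, h3⟩ := hy hyL
      exact ⟨h1, (hD _).2 h2, h3⟩
    surjective := fun x hx => surjective_dMoment (hnondeg _ ((hD x).1 hx))
    symplectic := fun x hx => exists_reducedForm (hnondeg _ ((hD x).1 hx)) }

/-! ### The two domains, and regular conjugators along the orbit. -/

theorem exists_smul_eq_of_mk_eq {L : TakiffDual m r} {x y : levelSet L}
    (h : Quotient.mk (reductionSetoid L) x = Quotient.mk (reductionSetoid L) y) :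
    ∃ g : TakiffGroup m r, g • y.1 = x.1 := by
  obtain ⟨g, hg⟩ := Quotient.exact h
  exact ⟨g, hg⟩

theorem mk_mem_domainQ {L : TakiffDual m r} (x : levelSet L) :
    Quotient.mk (reductionSetoid L) x ∈ domainQ L ↔ IsUnit x.1.Q := by
  constructor
  · rintro ⟨y, hy, hyx⟩
    obtain ⟨g, hg⟩ := exists_smul_eq_of_mk_eq hyx.symm
    rw [← hg, Q_smul]
    exact ((Takiff.isUnit_iff _).2 hy).mul (Units.isUnit _)
  · exact fun h => ⟨x, (Takiff.isUnit_iff _).1 h, rfl⟩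

theorem mk_mem_domainP {L : TakiffDual m r} (x : levelSet L) :
    Quotient.mk (reductionSetoid L) x ∈ domainP L ↔ IsUnit x.1.P.shift := by
  have h0 : ∀ y : PhaseSpace m r, IsUnit (y.P.coeff (Fin.last r)) ↔ IsUnit y.P.shift := fun y => by
    rw [Takiff.isUnit_iff, coeff_shift, Fin.rev_zero]
  constructor
  · rintro ⟨y, hy, hyx⟩
    obtain ⟨g, hg⟩ := exists_smul_eq_of_mk_eq hyx.symm
    rw [← hg, shift_P_smul]
    exact (Units.isUnit _).mul ((h0 _).1 hy)
  · exact fun h => ⟨x, (h0 _).2 h, rfl⟩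

/-- Left multiplication by an invertible element as a linear isomorphism. -/
noncomputable def mulLeftEquiv (g : TakiffGroup m r) : Takiff m r ≃ₗ[ℂ] Takiff m r :=
  LinearEquiv.ofLinearMap (mulBilin m r g) (mulBilin m r (g⁻¹ : TakiffGroup m r))
    (by ext1 h; simp) (by ext1 h; simp)

theorem finrank_range_comp_equiv {E E' : Type*} [AddCommGroup E] [Module ℂ E] [AddCommGroup E']
    [Module ℂ E'] (T : E →ₗ[ℂ] E') (e : E ≃ₗ[ℂ] E) (e' : E' ≃ₗ[ℂ] E') :
    Module.finrank ℂ (LinearMap.range (e'.toLinearMap ∘ₗ T ∘ₗ e.toLinearMap)) =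
      Module.finrank ℂ (LinearMap.range T) := by
  rw [LinearMap.range_comp, LinearEquiv.range_comp]
  exact LinearEquiv.finrank_map_eq e' _

/-- The linear map `q ↦ q b - a q`, whose invertible kernel elements conjugate `b` to `a`. -/
noncomputable def intertwiner (a b : Takiff m r) : Takiff m r →ₗ[ℂ] Takiff m r :=
  (mulBilin m r).flip b - mulBilin m r a

@[simp] theorem intertwiner_apply (a b q : Takiff m r) : intertwiner a b q = q * b - a * q := rfl

/-- The intertwiner of `g a g⁻¹` and `b` is that of `a` and `b`, preceded by left multiplication by
`g⁻¹` and followed by left multiplication by `g`. Hence the rank is constant as the first argument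
runs over an orbit. -/
theorem finrank_range_intertwiner_conj (a b : Takiff m r) (g : TakiffGroup m r) :
    Module.finrank ℂ (LinearMap.range (intertwiner (g.1 * a * g⁻¹.1) b)) =
      Module.finrank ℂ (LinearMap.range (intertwiner a b)) := by
  rw [← finrank_range_comp_equiv (intertwiner a b) (mulLeftEquiv g).symm (mulLeftEquiv g)]
  refine congrArg (fun T => Module.finrank ℂ (LinearMap.range T)) (LinearMap.ext fun q => ?_)
  change q * b - _ = (g : Takiff m r) * (((g⁻¹ : TakiffGroup m r) : Takiff m r) * q * b - a * (((g⁻¹ : TakiffGroup m r) : Takiff m r) * q))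
  simp [mul_sub, ← mul_assoc]

/-- This provides a local regular section of the orbit map `g ↦ g • L`. Constant rank extends a
conjugator `g` at `a` to nearby intertwiners, and these remain invertible because invertibility is
an open condition. -/
theorem exists_regular_conjugator {L a : TakiffDual m r}
    (ha : a ∈ MulAction.orbit (TakiffGroup m r) L) :
    ∃ q w : TakiffDual m r → Takiff m r, IsRegAt a q ∧ IsRegAt a w ∧ ∀ᶠ y in zNhds a,
      y ∈ MulAction.orbit (TakiffGroup m r) L →
        q y * w y = 1 ∧ w y * q y = 1 ∧ q y * L.shift = y.shift * q y := by
  have hshift : IsRegAt a (fun y : TakiffDual m r => y.shift) :=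
    (isRegAt_id a).linear (shiftEquiv m r).toLinearMap
  have hrank : ∀ y ∈ MulAction.orbit (TakiffGroup m r) L,
      Module.finrank ℂ (LinearMap.range (intertwiner y.shift L.shift)) =
        Module.finrank ℂ (LinearMap.range (intertwiner L.shift L.shift)) := by
    rintro _ ⟨g, rfl⟩
    change Module.finrank ℂ (LinearMap.range (intertwiner (g • L).shift L.shift)) = _
    rw [shift_coadjoint, finrank_range_intertwiner_conj]
  obtain ⟨g, hg⟩ := ha
  have hg' : a.shift = g * L.shift * (g⁻¹ : TakiffGroup m r) := by
    rw [← shift_coadjoint]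
    exact congrArg _ hg.symm
  obtain ⟨q, hq, hqa, h⟩ := exists_regular_kernel_section
    (T := fun y : TakiffDual m r => intertwiner y.shift L.shift) (x := a)
    (S := MulAction.orbit (TakiffGroup m r) L) (v := (g : Takiff m r))
    (fun e => (isRegAt_const a (e * L.shift)).sub (hshift.linear ((mulBilin m r).flip e)))
    (fun y hy => (hrank y hy).trans (hrank a ⟨g, hg⟩).symm)
    (by rw [intertwiner_apply, hg']; simp)
  obtain ⟨w, hw, h'⟩ := exists_regular_inverse hq (by rw [hqa]; exact g.isUnit)
  refine ⟨q, w, hq, hw, ?_⟩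
  filter_upwards [h, h'] with y hy hy' hyL
  exact ⟨hy'.1, hy'.2, sub_eq_zero.1 (hy hyL)⟩

theorem isSymplectomorphismOn_domainQ (L : TakiffDual m r) :
    IsSymplectomorphismOn L (domainQ L) := by
  refine isSymplectomorphismOn_of_local_sections (U := {x | IsUnit x.Q}) (isOpen_isUnit (linQ m r))
    mk_mem_domainQ (fun x hx => Or.inl hx) ?_ ?_ ?_
  · rintro x ⟨g, hg⟩
    refine ⟨g, TakiffDual.shift_injective ?_⟩
    change (g • momentInner x).shift = _
    rw [shift_coadjoint, shift_momentInner, shift_matA, ← hg]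
    simp [mul_assoc]
  · rintro x ⟨g, hg⟩ y ⟨h, hh⟩ hL hA
    refine ⟨g⁻¹ * h, phaseSpace_ext ?_ ?_⟩
    · rw [Q_smul, ← hg, ← hh]
      simp
    · have := congrArg TakiffDual.shift hA
      rw [shift_matA, shift_matA, ← hg, ← hh] at this
      rw [shift_P_smul, Units.val_mul, mul_assoc, ← this]
      simp
  · intro a ha
    obtain ⟨q, w, hq, hw, h⟩ := exists_regular_conjugator ha
    -- With `w = q⁻¹`, the pair `(q, L q⁻¹)` has `p q = L` and `q p = q L q⁻¹ = y`.
    refine ⟨fun y => PhaseSpace.mk (q y) (L.shift * w y),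
      hq.phaseSpace_mk (hw.linear (mulBilin m r L.shift)), h.mono fun y hy hyL => ?_⟩
    obtain ⟨h1, h2, h3⟩ := hy hyL
    refine ⟨TakiffDual.shift_injective ?_, isUnit_iff_exists.2 ⟨w y, h1, h2⟩,
      TakiffDual.shift_injective ?_⟩
    · rw [shift_momentInner, PhaseSpace.shift_P_mk, PhaseSpace.Q_mk, mul_assoc, h2, mul_one]
    · rw [shift_matA, PhaseSpace.shift_P_mk, PhaseSpace.Q_mk, ← mul_assoc, h3, mul_assoc, h1,
        mul_one]

theorem isSymplectomorphismOn_domainP (L : TakiffDual m r) :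
    IsSymplectomorphismOn L (domainP L) := by
  refine isSymplectomorphismOn_of_local_sections (U := {x | IsUnit x.P.shift})
    (isOpen_isUnit (linP m r)) mk_mem_domainP (fun x hx => Or.inr hx) ?_ ?_ ?_
  · rintro x ⟨g, hg⟩
    refine ⟨g⁻¹, TakiffDual.shift_injective ?_⟩
    change (g⁻¹ • momentInner x).shift = _
    rw [shift_coadjoint, shift_momentInner, shift_matA, ← hg]
    simp
  · rintro x ⟨g, hg⟩ y ⟨h, hh⟩ hL hA
    refine ⟨g * h⁻¹, phaseSpace_ext ?_ ?_⟩
    · have := congrArg TakiffDual.shift hA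
      rw [shift_matA, shift_matA, ← hg, ← hh] at this
      rw [Q_smul, mul_inv_rev, inv_inv, Units.val_mul, ← mul_assoc, ← this]
      simp
    · rw [shift_P_smul, ← hg, ← hh]
      simp
  · intro a ha
    obtain ⟨q, w, hq, hw, h⟩ := exists_regular_conjugator ha
    -- With `w = q⁻¹`, the pair `(q L, q⁻¹)` has the same two products, and now the `P` component is
    -- the invertible one.
    refine ⟨fun y => PhaseSpace.mk (q y * L.shift) (w y),
      (hq.linear ((mulBilin m r).flip L.shift)).phaseSpace_mk hw, h.mono fun y hy hyL => ?_⟩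
    obtain ⟨h1, h2, h3⟩ := hy hyL
    refine ⟨TakiffDual.shift_injective ?_, ?_, TakiffDual.shift_injective ?_⟩
    · rw [shift_momentInner, PhaseSpace.shift_P_mk, PhaseSpace.Q_mk, ← mul_assoc, h2, one_mul]
    · rw [Set.mem_ofPred_eq, PhaseSpace.shift_P_mk]
      exact isUnit_iff_exists.2 ⟨q y, h2, h1⟩
    · rw [shift_matA, PhaseSpace.shift_P_mk, PhaseSpace.Q_mk, h3, mul_assoc, h1, mul_one]

/-- The constant term of `p q` is `P r * Q 0`, which equals the leading coefficient of `L`. If this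
square matrix is invertible, so are both factors, by determinants. -/
theorem isUnit_of_isUnit_coeff_last {L : TakiffDual m r} (hL : IsUnit (L.coeff (Fin.last r)))
    (x : levelSet L) : IsUnit x.1.Q ∧ IsUnit x.1.P.shift := by
  have h : IsUnit (x.1.P.shift.coeff 0 * x.1.Q.coeff 0) := by
    rw [← Takiff.coeff_zero_mul, ← shift_momentInner, x.2, coeff_shift, Fin.rev_zero]
    exact hL
  rw [Takiff.isUnit_iff, Takiff.isUnit_iff]
  rw [Matrix.isUnit_iff_isUnit_det, Matrix.det_mul, IsUnit.mul_iff] at h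
  exact ⟨(Matrix.isUnit_iff_isUnit_det _).2 h.2, (Matrix.isUnit_iff_isUnit_det _).2 h.1⟩

end Reduction

end TakiffReduction

theorem mainTheorem8 (m r : ℕ) :
    InnerActionIsHamiltonian m r ∧
    (∀ (x : PhaseSpace m r) (k : Fin (r + 1)),
      (matA x).coeff k =
        ∑ i : Fin (r - k + 1), x.Q.coeff ⟨i, by omega⟩ * x.P.coeff ⟨i + k, by omega⟩ ∧
      (momentInner x).coeff k =
        ∑ i : Fin (r - k + 1), x.P.coeff ⟨i + k, by omega⟩ * x.Q.coeff ⟨i, by omega⟩) ∧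
    ∀ L : TakiffDual m r,
      IsSymplectomorphismOn L (domainQ L) ∧
      IsSymplectomorphismOn L (domainP L) ∧
      (IsUnit (L.coeff (Fin.last r)) → domainQ L = Set.univ ∧ domainP L = Set.univ) := by
  refine ⟨innerActionIsHamiltonian m r, fun x k => ⟨coeff_matA x k, coeff_momentInner x k⟩,
    fun L => ⟨isSymplectomorphismOn_domainQ L, isSymplectomorphismOn_domainP L, fun hL => ⟨?_, ?_⟩⟩⟩
  · refine Set.eq_univ_of_forall fun d => ?_
    induction d using Quotient.inductionOn with | _ x =>
    exact (mk_mem_domainQ x).2 (isUnit_of_isUnit_coeff_last hL x).1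
  · refine Set.eq_univ_of_forall fun d => ?_
    induction d using Quotient.inductionOn with | _ x =>
    exact (mk_mem_domainP x).2 (isUnit_of_isUnit_coeff_last hL x).2
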